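/- Let $(M^m,g)$ and $(N^n,h)$ be smooth Riemannian manifolds (without boundary) with $m>n\ge 1$. For a smooth map $\varphi:(M,g)\to(N,h)$ let $\tau(\varphi)=\mathrm{trace}\,\nabla \mathrm{d}\varphi$ be its tension field, $e(\varphi)=\frac12|\mathrm{d}\varphi|^2$ its energy density, $\mathfrak{C}_\varphi=\mathrm{d}\varphi^t\circ \mathrm{d}\varphi\in\mathrm{End}(TM)$ its Cauchy-Green tensor, and $$\tau_{\sigma_2}(\varphi)=2\left[e(\varphi)\tau(\varphi)+\mathrm{d}\varphi(\mathrm{grad}\,e(\varphi))\right]-\mathrm{trace}\,(\nabla \mathrm{d}\varphi)\circ\mathfrak{C}_\varphi-\mathrm{d}\varphi(\mathrm{div}\,\mathfrak{C}_\varphi)$$ its $\sigma_2$-tension field. The map $\varphi$ is called harmonic if $\tau(\varphi)=0$, $\sigma_2$-critical if $\tau_{\sigma_2}(\varphi)=0$, and $\sigma_{1,2}$-critical with coupling constant $K\in\mathbb{R}$ if $\tau(\varphi)+K\tau_{\sigma_2}(\varphi)=0$ (these are the Euler-Lagrange equations of $\frac12\int_M|\mathrm{d}\varphi|^2\nu_g$,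 $\frac12\int_M|\wedge^2\mathrm{d}\varphi|^2\nu_g$ and $\frac12\int_M\left[|\mathrm{d}\varphi|^2+K|\wedge^2\mathrm{d}\varphi|^2\right]\nu_g$, respectively). Let $\varphi:(M^m,g)\to(N^n,h)$ be a submersive harmonic morphism with dilation $\lambda:M\to(0,\infty)$; that is, $\varphi$ is smooth and harmonic, every $\mathrm{d}\varphi_x$ is surjective, and $\varphi^*h=\lambda^2 g$ on $\mathcal{H}\times\mathcal{H}$, where $\mathcal{V}=\ker \mathrm{d}\varphi$ and $\mathcal{H}=\mathcal{V}^\perp$ (with respect to $g$). Let $g^{\mathcal H}$ and $g^{\mathcal V}$ denote the horizontal and vertical parts of $g$ and, for a smooth function $\rho:M\to(0,\infty)$, let $$g_\rho=\rho^{-2}g^{\mathcal{H}}+\rho^{\frac{2n-4}{m-n}}g^{\mathcal{V}}.$$ Then $\lambda$ is smooth, and: (i) The biconformally related metric $g_{1/\lambda}$ is a smooth Riemannian metric on $M$, and for every $K\in\mathbb{R}$ the map $\varphi$ is $\sigma_{1,2}$-critical with respect to $g_{1/\lambda}$ on $M$ and $h$ on $N$. (ii) For every $K\in\mathbb{R}$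 and every smooth function $b:M\to(0,\infty)$, the map $\varphi$ is $\sigma_{1,2}$-critical with respect to the conformally related metric $b^2 g$ on $M$ (and $h$ on $N$) if and only if $$\mathrm{grad}^{\mathcal{H}}\left[b^{m-4}\left(b^2+K(n-1)\lambda^2\right)\right]=0,$$ where $\mathrm{grad}^{\mathcal{H}}$ is the horizontal part of the gradient with respect to $g$. (iii) If $m\neq4$, then $\varphi$ is $\sigma_2$-critical with respect to the conformally related metric $\lambda^{\frac{4}{4-m}}g$ on $M$ (and $h$ on $N$). -/

import Mathlib

open scoped Manifold ContDiff

noncomputable section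

namespace SigmaCritical

/-- The Euclidean space `ℝ^d` on which `d`-dimensional manifolds are modelled. -/
abbrev E (d : ℕ) : Type := EuclideanSpace ℝ (Fin d)

/-- A smooth (`C^∞`) Riemannian metric on a smooth manifold `M` of dimension `d`
(without boundary). -/
abbrev SmoothMetric (d : ℕ) (M : Type*) [TopologicalSpace M] [ChartedSpace (E d) M]
    [IsManifold (𝓡 d) ∞ M] : Type _ :=
  Bundle.ContMDiffRiemannianMetric (𝓡 d) ∞ (E d) (fun x : M => TangentSpace (𝓡 d) x)

/-! ### Local expressions

All the local expressions below are taken in the chart `extChartAt (𝓡 d) p` of a point `p`; the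
variable `u` is a point of the model space `ℝ^d`, i.e. a coordinate vector of a point near `p`. -/

section Local

variable {d : ℕ} {M : Type*} [TopologicalSpace M] [ChartedSpace (E d) M] [IsManifold (𝓡 d) ∞ M]

/-- The partial derivative `∂_i f (u)`. -/
def pderiv (i : Fin d) (f : E d → ℝ) (u : E d) : ℝ :=
  fderiv ℝ f u (EuclideanSpace.single i 1)

/-- The coordinate vector field `∂_i` of the chart of `M` at `p`, at the point with
coordinates `u`. -/
def coordVec (p : M) (u : E d) (i : Fin d) :
    TangentSpace (𝓡 d) ((extChartAt (𝓡 d) p).symm u) :=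
  mfderiv 𝓘(ℝ, E d) (𝓡 d) (extChartAt (𝓡 d) p).symm u (EuclideanSpace.single i 1 : E d)

/-- The matrix `(g_{ij}(u))` of the metric in the chart at `p`. Its inverse is `(g^{ij}(u))`. -/
def gram (g : SmoothMetric d M) (p : M) (u : E d) : Matrix (Fin d) (Fin d) ℝ :=
  Matrix.of fun i j => g.inner _ (coordVec p u i) (coordVec p u j)

/-- The Christoffel symbol `Γ^k_{ij}(u)` of the Levi-Civita connection of `g` in the chart
at `p`. -/
def christoffel (g : SmoothMetric d M) (p : M) (u : E d) (k i j : Fin d) : ℝ :=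
  (1 / 2 : ℝ) * ∑ l, (gram g p u)⁻¹ k l *
    (pderiv i (fun w => gram g p w j l) u + pderiv j (fun w => gram g p w i l) u
      - pderiv l (fun w => gram g p w i j) u)

end Local

section Maps

variable {m n : ℕ}
  {M : Type*} [TopologicalSpace M] [ChartedSpace (E m) M] [IsManifold (𝓡 m) ∞ M]
  {N : Type*} [TopologicalSpace N] [ChartedSpace (E n) N] [IsManifold (𝓡 n) ∞ N]

/-- The local representative of `φ` in the charts at `p` and `φ p`. -/
def localRep (φ : M → N) (p : M) (u : E m) : E n :=
  extChartAt (𝓡 n) (φ p) (φ ((extChartAt (𝓡 m) p).symm u))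

/-- `∂_i φ^α (u)`. -/
def dcoord (φ : M → N) (p : M) (u : E m) (α : Fin n) (i : Fin m) : ℝ :=
  pderiv i (fun w => localRep φ p w α) u

/-- The second fundamental form
`(∇dφ)^α_{ij} = ∂_i ∂_j φ^α - Γ^k_{ij} ∂_k φ^α + Γ^α_{βγ}(φ) ∂_i φ^β ∂_j φ^γ`. -/
def secondForm (g : SmoothMetric m M) (h : SmoothMetric n N) (φ : M → N) (p : M) (u : E m)
    (α : Fin n) (i j : Fin m) : ℝ :=
  pderiv i (fun w => dcoord φ p w α j) u
    - ∑ k, christoffel g p u k i j * dcoord φ p u α k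
    + ∑ β, ∑ γ, christoffel h (φ p) (localRep φ p u) α β γ * dcoord φ p u β i * dcoord φ p u γ j

/-- The Cauchy-Green tensor `ℭ_φ = dφᵗ ∘ dφ ∈ End(TM)` (the transpose being the adjoint with
respect to `g` and `h`): `ℭ^k_j = g^{kl} h_{αβ}(φ) ∂_l φ^α ∂_j φ^β`. -/
def cauchyGreen (g : SmoothMetric m M) (h : SmoothMetric n N) (φ : M → N) (p : M) (u : E m)
    (k j : Fin m) : ℝ :=
  ∑ l, (gram g p u)⁻¹ k l *
    ∑ α, ∑ β, gram h (φ p) (localRep φ p u) α β * dcoord φ p u α l * dcoord φ p u β j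

/-- The energy density `e(φ) = |dφ|² / 2 = trace ℭ_φ / 2`. -/
def energyDensity (g : SmoothMetric m M) (h : SmoothMetric n N) (φ : M → N) (p : M)
    (u : E m) : ℝ :=
  (1 / 2 : ℝ) * ∑ i, cauchyGreen g h φ p u i i

/-- `(grad e(φ))^k = g^{kl} ∂_l e(φ)`. -/
def gradEnergyDensity (g : SmoothMetric m M) (h : SmoothMetric n N) (φ : M → N) (p : M)
    (u : E m) (k : Fin m) : ℝ :=
  ∑ l, (gram g p u)⁻¹ k l * pderiv l (energyDensity g h φ p) u

/-- `∇_i ℭ^k_j = ∂_i ℭ^k_j + Γ^k_{il} ℭ^l_j - Γ^l_{ij} ℭ^k_l`. -/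
def covDerivCauchyGreen (g : SmoothMetric m M) (h : SmoothMetric n N) (φ : M → N) (p : M)
    (u : E m) (i k j : Fin m) : ℝ :=
  pderiv i (fun w => cauchyGreen g h φ p w k j) u
    + ∑ l, christoffel g p u k i l * cauchyGreen g h φ p u l j
    - ∑ l, christoffel g p u l i j * cauchyGreen g h φ p u k l

/-- The vector field `div ℭ_φ = trace ∇ℭ_φ`: `(div ℭ)^k = g^{ij} ∇_i ℭ^k_j`. -/
def divCauchyGreen (g : SmoothMetric m M) (h : SmoothMetric n N) (φ : M → N) (p : M)
    (u : E m) (k : Fin m) : ℝ :=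
  ∑ i, ∑ j, (gram g p u)⁻¹ i j * covDerivCauchyGreen g h φ p u i k j

/-! ### Tension fields

The tangent space `TangentSpace (𝓡 n) y` is, by definition in Mathlib, the model space `ℝ^n`
seen through the chart of `N` at `y`; so a vector tangent to `N` at `φ p` is given by its
components in the chart at `φ p`. -/

/-- The tension field `τ(φ) = trace ∇dφ` at `p`: `τ^α = g^{ij} (∇dφ)^α_{ij}`. -/
def tension (g : SmoothMetric m M) (h : SmoothMetric n N) (φ : M → N) (p : M) :
    TangentSpace (𝓡 n) (φ p) :=
  let u := extChartAt (𝓡 m) p p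
  (WithLp.toLp 2 fun α => ∑ i, ∑ j, (gram g p u)⁻¹ i j * secondForm g h φ p u α i j : E n)

/-- The `σ₂`-tension field at `p`,
`τ_{σ₂}(φ) = 2 [e(φ) τ(φ) + dφ(grad e(φ))] - trace (∇dφ) ∘ ℭ_φ - dφ(div ℭ_φ)`,
where `trace (∇dφ) ∘ ℭ_φ = g^{ij} (∇dφ)(∂_i, ℭ_φ ∂_j)`. -/
def sigmaTwoTension (g : SmoothMetric m M) (h : SmoothMetric n N) (φ : M → N) (p : M) :
    TangentSpace (𝓡 n) (φ p) :=
  let u := extChartAt (𝓡 m) p p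
  (WithLp.toLp 2 fun α =>
    2 * (energyDensity g h φ p u * (∑ i, ∑ j, (gram g p u)⁻¹ i j * secondForm g h φ p u α i j)
        + ∑ k, dcoord φ p u α k * gradEnergyDensity g h φ p u k)
      - ∑ i, ∑ j, (gram g p u)⁻¹ i j *
          ∑ k, cauchyGreen g h φ p u k j * secondForm g h φ p u α i k
      - ∑ k, dcoord φ p u α k * divCauchyGreen g h φ p u k : E n)

/-- `φ` is harmonic: `τ(φ) = 0`. -/
def IsHarmonic (g : SmoothMetric m M) (h : SmoothMetric n N) (φ : M → N) : Prop :=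
  ∀ p, tension g h φ p = 0

/-- `φ` is `σ₂`-critical: `τ_{σ₂}(φ) = 0`. -/
def IsSigmaTwoCritical (g : SmoothMetric m M) (h : SmoothMetric n N) (φ : M → N) : Prop :=
  ∀ p, sigmaTwoTension g h φ p = 0

/-- `φ` is `σ_{1,2}`-critical with coupling constant `K`: `τ(φ) + K τ_{σ₂}(φ) = 0`. -/
def IsSigmaOneTwoCritical (K : ℝ) (g : SmoothMetric m M) (h : SmoothMetric n N) (φ : M → N) :
    Prop :=
  ∀ p, tension g h φ p + K • sigmaTwoTension g h φ p = 0

end Maps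

/-! ### Gradient, vertical and horizontal distributions -/

section Distributions

variable {m n : ℕ}
  {M : Type*} [TopologicalSpace M] [ChartedSpace (E m) M] [IsManifold (𝓡 m) ∞ M]
  {N : Type*} [TopologicalSpace N] [ChartedSpace (E n) N] [IsManifold (𝓡 n) ∞ N]

instance (x : M) : FiniteDimensional ℝ (TangentSpace (𝓡 m) x) :=
  inferInstanceAs (FiniteDimensional ℝ (E m))

/-- The bilinear form `g_x` on `T_x M`. -/
def metricForm (g : SmoothMetric m M) (x : M) : LinearMap.BilinForm ℝ (TangentSpace (𝓡 m) x) :=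
  LinearMap.mk₂ ℝ (fun v w => g.inner x v w) (by simp) (by simp) (by simp) (by simp)

theorem metricForm_apply (g : SmoothMetric m M) (x : M) (v w : TangentSpace (𝓡 m) x) :
    metricForm g x v w = g.inner x v w := rfl

theorem metricForm_self_eq_zero (g : SmoothMetric m M) (x : M) (v : TangentSpace (𝓡 m) x)
    (hv : metricForm g x v v = 0) : v = 0 := by
  by_contra hne
  exact (g.pos x v hne).ne' hv

theorem metricForm_isSymm (g : SmoothMetric m M) (x : M) : (metricForm g x).IsSymm :=
  ⟨fun v w => g.symm x v w⟩

theorem metricForm_nondegenerate (g : SmoothMetric m M) (x : M) :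
    (metricForm g x).Nondegenerate :=
  ⟨fun v hv => metricForm_self_eq_zero g x v (hv v),
    fun v hv => metricForm_self_eq_zero g x v (hv v)⟩

/-- The gradient of `f` with respect to `g`: `g(grad f, w) = df(w)` for all `w`. -/
def gradient (g : SmoothMetric m M) (f : M → ℝ) (x : M) : TangentSpace (𝓡 m) x :=
  ((metricForm g x).toDual (metricForm_nondegenerate g x)).symm
    (mfderiv (𝓡 m) 𝓘(ℝ, ℝ) f x : TangentSpace (𝓡 m) x →L[ℝ] ℝ).toLinearMap

variable (n) in
/-- The vertical space `𝒱_x = ker dφ_x`. -/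
def vertical (φ : M → N) (x : M) : Submodule ℝ (TangentSpace (𝓡 m) x) :=
  LinearMap.ker (mfderiv (𝓡 m) (𝓡 n) φ x).toLinearMap

variable (n) in
/-- The horizontal space `ℋ_x = (ker dφ_x)^⊥`, the orthogonal complement being taken with respect
to `g`. -/
def horizontal (g : SmoothMetric m M) (φ : M → N) (x : M) :
    Submodule ℝ (TangentSpace (𝓡 m) x) :=
  (metricForm g x).orthogonal (vertical n φ x)

variable (n) in
theorem isCompl_horizontal_vertical (g : SmoothMetric m M) (φ : M → N) (x : M) :
    IsCompl (horizontal n g φ x) (vertical n φ x) := by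
  refine IsCompl.symm ?_
  refine (LinearMap.BilinForm.isCompl_orthogonal_iff_disjoint
    (metricForm_isSymm g x).isRefl).2 ?_
  rw [Submodule.disjoint_def]
  intro v hv hv'
  exact metricForm_self_eq_zero g x v (hv' v hv)

variable (n) in
/-- The orthogonal projection of `T_x M` onto `ℋ_x`. -/
def horizontalProj (g : SmoothMetric m M) (φ : M → N) (x : M) :
    TangentSpace (𝓡 m) x →ₗ[ℝ] TangentSpace (𝓡 m) x :=
  (horizontal n g φ x).projection (vertical n φ x) (isCompl_horizontal_vertical n g φ x)

variable (n) in
/-- The orthogonal projection of `T_x M` onto `𝒱_x`. -/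
def verticalProj (g : SmoothMetric m M) (φ : M → N) (x : M) :
    TangentSpace (𝓡 m) x →ₗ[ℝ] TangentSpace (𝓡 m) x :=
  (vertical n φ x).projection (horizontal n g φ x) (isCompl_horizontal_vertical n g φ x).symm

variable (n) in
/-- The horizontal gradient `grad^ℋ f`. -/
def horizontalGradient (g : SmoothMetric m M) (φ : M → N) (f : M → ℝ) (x : M) :
    TangentSpace (𝓡 m) x :=
  horizontalProj n g φ x (gradient g f x)

/-- `φ` is a (smooth, submersive) horizontally conformal map `(M, g) → (N, h)` of dilation `lam`:
at every point `dφ_x` is onto, and `φ^*h = lam² g` on `ℋ_x × ℋ_x`, with `lam x > 0`. -/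
structure IsHorizontallyConformal (g : SmoothMetric m M) (h : SmoothMetric n N) (φ : M → N)
    (lam : M → ℝ) : Prop where
  smooth : ContMDiff (𝓡 m) (𝓡 n) ∞ φ
  surjective : ∀ x, Function.Surjective (mfderiv (𝓡 m) (𝓡 n) φ x)
  pos : ∀ x, 0 < lam x
  conformal : ∀ x, ∀ v ∈ horizontal n g φ x, ∀ w ∈ horizontal n g φ x,
    h.inner (φ x) (mfderiv (𝓡 m) (𝓡 n) φ x v) (mfderiv (𝓡 m) (𝓡 n) φ x w)
      = lam x ^ 2 * g.inner x v w

/-- `φ` is a submersive harmonic morphism of dilation `lam`: it is harmonic and horizontally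
conformal. -/
structure IsSubmersiveHarmonicMorphism (g : SmoothMetric m M) (h : SmoothMetric n N) (φ : M → N)
    (lam : M → ℝ) : Prop extends IsHorizontallyConformal g h φ lam where
  harmonic : IsHarmonic g h φ

/-! ### Related metrics -/

/-- `G` is the metric `a · g` conformal to `g` with conformal factor `a`. -/
def IsConformalMetric (g : SmoothMetric m M) (a : M → ℝ) (G : SmoothMetric m M) : Prop :=
  ∀ x (v w : TangentSpace (𝓡 m) x), G.inner x v w = a x * g.inner x v w

variable (n) in
/-- `G` is the metric `g_ρ = ρ^{-2} g^ℋ + ρ^{(2n-4)/(m-n)} g^𝒱` biconformally related to `g` with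
respect to `𝒱 = ker dφ`, where `ρ : M → (0, ∞)` is smooth; here `g^ℋ` and `g^𝒱` are the
restrictions of `g` to the horizontal and vertical parts of vectors. -/
structure IsBiconformalMetric (g : SmoothMetric m M) (φ : M → N) (ρ : M → ℝ)
    (G : SmoothMetric m M) : Prop where
  smooth : ContMDiff (𝓡 m) 𝓘(ℝ, ℝ) ∞ ρ
  pos : ∀ x, 0 < ρ x
  eq : ∀ x (v w : TangentSpace (𝓡 m) x), G.inner x v w =
    ρ x ^ (-2 : ℤ) * g.inner x (horizontalProj n g φ x v) (horizontalProj n g φ x w)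
      + ρ x ^ ((2 * (n : ℝ) - 4) / ((m : ℝ) - (n : ℝ)))
        * g.inner x (verticalProj n g φ x v) (verticalProj n g φ x w)

end Distributions

end SigmaCritical

end

set_option linter.unusedSectionVars false

noncomputable section

namespace SigmaCritical

/-! ### Calculus of matrix-valued functions -/

section MatrixCalculus

variable {d : ℕ} {ι κ μ : Type*} {u : E d}

/-! Every metric in the statement has the form G = c g + e φ^*h: it is c g on the vertical space and
(c + eλ²) g on the horizontal one. Writing it this way avoids differentiating the projections, since
φ^*h is smooth as soon as φ and h are (`exists_isRelatedMetric`).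

In coordinates let A be the Jacobian of φ, H the matrix of h along φ, and Y = g⁻¹Aᵗ the matrix of
the gradients of the coordinates of φ. Horizontal conformality becomes A Y H = λ² 1
(`jacobian_mul_coordGradients`), which also shows that λ² is smooth, hence so is λ > 0. Passing from
g to G multiplies Y by s = 1/(c + eλ²), and det g by v², where v² = c^(m-n) (c + eλ²)^n.

Two formulas then carry the proof. The tension field is a divergence plus a term in the Christoffel
symbols of h that is linear in Y (`localTension_eq`), so τ_G = s τ_g + v⁻¹ dφ(grad(vs)), the
gradient being that of g. For a horizontally conformal map of squared dilation L, dφ ∘ ℭ = L dφ and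
e(φ) = nL/2, so the product rule gives τ_σ₂ = (n-1)(Lτ + dφ(grad L)) (`localSigmaTwoTension_eq`).

With τ_g = 0 and L = sλ² for G, these combine to aτ + Kτ_σ₂ = v⁻¹ dφ(grad f), f = a vs + K(n-1) v s²
λ². Since dφ kills exactly the vertical vectors, the equation says that the horizontal gradient of f
vanishes (`tension_add_sigmaTwoTension_eq_zero_iff`). In (i) and (iii) the exponents are such that f
is constant; in (ii) f is the displayed function. -/

theorem pderiv_congr {f f' : E d → ℝ} (h : f =ᶠ[nhds u] f') (i : Fin d) :
    pderiv i f u = pderiv i f' u := by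
  simp only [pderiv, h.fderiv_eq]

theorem pderiv_mul {f f' : E d → ℝ} (hf : DifferentiableAt ℝ f u) (hf' : DifferentiableAt ℝ f' u)
    (i : Fin d) :
    pderiv i (fun w => f w * f' w) u = pderiv i f u * f' u + f u * pderiv i f' u := by
  simp only [pderiv]
  rw [fderiv_fun_mul hf hf']
  simp only [add_apply, smul_apply, smul_eq_mul]
  ring

theorem pderiv_const_mul {f : E d → ℝ} (hf : DifferentiableAt ℝ f u) (c : ℝ) (i : Fin d) :
    pderiv i (fun w => c * f w) u = c * pderiv i f u := by
  simp only [pderiv]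
  rw [fderiv_const_mul hf]
  simp

theorem pderiv_const (c : ℝ) (i : Fin d) : pderiv i (fun _ : E d => c) u = 0 := by
  simp [pderiv]

theorem pderiv_add {f f' : E d → ℝ} (hf : DifferentiableAt ℝ f u) (hf' : DifferentiableAt ℝ f' u)
    (i : Fin d) : pderiv i (fun w => f w + f' w) u = pderiv i f u + pderiv i f' u := by
  simp only [pderiv]
  rw [fderiv_fun_add hf hf']
  rfl

theorem pderiv_sum {s : Finset ι} {f : ι → E d → ℝ} (hf : ∀ a ∈ s, DifferentiableAt ℝ (f a) u)
    (i : Fin d) : pderiv i (fun w => ∑ a ∈ s, f a w) u = ∑ a ∈ s, pderiv i (f a) u := by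
  simp only [pderiv]
  rw [fderiv_fun_sum hf]
  simp

/-- The entrywise partial derivative of a matrix-valued function. -/
def matPderiv (i : Fin d) (A : E d → Matrix ι κ ℝ) (u : E d) : Matrix ι κ ℝ :=
  Matrix.of fun a b => pderiv i (fun w => A w a b) u

theorem matPderiv_apply (i : Fin d) (A : E d → Matrix ι κ ℝ) (a : ι) (b : κ) :
    matPderiv i A u a b = pderiv i (fun w => A w a b) u := rfl

/-- Entrywise smoothness of a matrix-valued function at a point. -/
def MatSmoothAt {F : Type*} [NormedAddCommGroup F] [NormedSpace ℝ F]
    (A : F → Matrix ι κ ℝ) (u : F) : Prop :=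
  ∀ a b, ContDiffAt ℝ ∞ (fun w => A w a b) u

theorem MatSmoothAt.differentiableAt {A : E d → Matrix ι κ ℝ} (hA : MatSmoothAt A u) (a : ι)
    (b : κ) : DifferentiableAt ℝ (fun w => A w a b) u :=
  (hA a b).differentiableAt (by simp)

theorem matPderiv_congr {A B : E d → Matrix ι κ ℝ} (h : A =ᶠ[nhds u] B) (i : Fin d) :
    matPderiv i A u = matPderiv i B u := by
  ext a b
  exact pderiv_congr (h.mono fun w hw => congrFun (congrFun hw a) b) i

theorem matPderiv_mul [Fintype κ] {A : E d → Matrix ι κ ℝ} {B : E d → Matrix κ μ ℝ}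
    (hA : MatSmoothAt A u) (hB : MatSmoothAt B u) (i : Fin d) :
    matPderiv i (fun w => A w * B w) u = matPderiv i A u * B u + A u * matPderiv i B u := by
  ext a b
  simp only [matPderiv_apply, Matrix.add_apply, Matrix.mul_apply]
  rw [← Finset.sum_add_distrib]
  exact (pderiv_sum (f := fun c w => A w a c * B w c b)
    (fun c _ => (hA.differentiableAt a c).mul (hB.differentiableAt c b)) i).trans
    (Finset.sum_congr rfl fun c _ =>
      pderiv_mul (hA.differentiableAt a c) (hB.differentiableAt c b) i)

theorem matPderiv_smul {f : E d → ℝ} {A : E d → Matrix ι κ ℝ} (hf : DifferentiableAt ℝ f u)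
    (hA : MatSmoothAt A u) (i : Fin d) :
    matPderiv i (fun w => f w • A w) u = pderiv i f u • A u + f u • matPderiv i A u := by
  ext a b
  exact pderiv_mul hf (hA.differentiableAt a b) i

/-! ### Entrywise smoothness of products, determinants and inverses -/

section Smooth

variable {F : Type*} [NormedAddCommGroup F] [NormedSpace ℝ F] {x : F}

theorem MatSmoothAt.mul [Fintype κ] {A : F → Matrix ι κ ℝ} {B : F → Matrix κ μ ℝ}
    (hA : MatSmoothAt A x) (hB : MatSmoothAt B x) : MatSmoothAt (fun w => A w * B w) x := by
  intro a b
  simp only [Matrix.mul_apply]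
  exact ContDiffAt.sum fun c _ => (hA a c).mul (hB c b)

theorem MatSmoothAt.transpose {A : F → Matrix ι κ ℝ} (hA : MatSmoothAt A x) :
    MatSmoothAt (fun w => (A w).transpose) x := fun a b => hA b a

theorem MatSmoothAt.smul {f : F → ℝ} {A : F → Matrix ι κ ℝ} (hf : ContDiffAt ℝ ∞ f x)
    (hA : MatSmoothAt A x) : MatSmoothAt (fun w => f w • A w) x := fun a b => hf.mul (hA a b)

theorem MatSmoothAt.add {A B : F → Matrix ι κ ℝ} (hA : MatSmoothAt A x) (hB : MatSmoothAt B x) :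
    MatSmoothAt (fun w => A w + B w) x := fun a b => (hA a b).add (hB a b)

theorem MatSmoothAt.congr {A B : F → Matrix ι κ ℝ} (hA : MatSmoothAt A x)
    (h : B =ᶠ[nhds x] A) : MatSmoothAt B x := fun a b =>
  (hA a b).congr_of_eventuallyEq (h.mono fun _ hw => congrFun (congrFun hw a) b)

variable [Fintype ι] [DecidableEq ι]

theorem MatSmoothAt.det {A : F → Matrix ι ι ℝ} (hA : MatSmoothAt A x) :
    ContDiffAt ℝ ∞ (fun w => (A w).det) x := by
  simp only [Matrix.det_apply']
  exact ContDiffAt.sum fun σ _ => contDiffAt_const.mul (contDiffAt_prod fun a _ => hA (σ a) a)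

theorem MatSmoothAt.inv {A : F → Matrix ι ι ℝ} (hA : MatSmoothAt A x) (h0 : (A x).det ≠ 0) :
    MatSmoothAt (fun w => (A w)⁻¹) x := by
  intro a b
  simp only [Matrix.inv_def, Matrix.smul_apply, Ring.inverse_eq_inv', smul_eq_mul,
    Matrix.adjugate_apply]
  -- By Cramer's rule an entry of the adjugate is the determinant of A with one row replaced by a
  -- constant one.
  refine (hA.det.inv h0).mul (MatSmoothAt.det fun c e => ?_)
  by_cases hc : c = b
  · subst hc
    simp only [Matrix.updateRow_self]
    exact contDiffAt_const
  · simp only [Matrix.updateRow_ne hc]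
    exact hA c e

end Smooth

/-- Differentiate A⁻¹A = 1, which holds on a neighbourhood of u because det A is continuous and
nonzero at u. -/
theorem matPderiv_inv {k : ℕ} {A : E d → Matrix (Fin k) (Fin k) ℝ} (hA : MatSmoothAt A u)
    (h0 : (A u).det ≠ 0) (i : Fin d) :
    matPderiv i (fun w => (A w)⁻¹) u = - ((A u)⁻¹ * matPderiv i A u * (A u)⁻¹) := by
  have hev : ∀ᶠ w in nhds u, (A w).det ≠ 0 := hA.det.continuousAt.eventually_ne h0
  have h1 : matPderiv i (fun w => (A w)⁻¹ * A w) u = 0 := by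
    rw [matPderiv_congr (B := fun _ => 1)
      (hev.mono fun w hw => Matrix.nonsing_inv_mul _ (isUnit_iff_ne_zero.2 hw))]
    ext a b
    exact pderiv_const _ _
  rw [matPderiv_mul (hA.inv h0) hA] at h1
  have h2 := congrArg (· * (A u)⁻¹) (eq_neg_of_add_eq_zero_left h1)
  simpa [Matrix.mul_assoc, Matrix.mul_nonsing_inv _ (isUnit_iff_ne_zero.2 h0)] using h2

/-- Jacobi's formula. -/
theorem pderiv_det {k : ℕ} {A : E d → Matrix (Fin k) (Fin k) ℝ} (hA : MatSmoothAt A u)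
    (h0 : (A u).det ≠ 0) (i : Fin d) :
    pderiv i (fun w => (A w).det) u = (A u).det * ((A u)⁻¹ * matPderiv i A u).trace := by
  have key : pderiv i (fun w => (A w).det) u
      = ∑ a, ((A u).updateRow a (matPderiv i A u a)).det := by
    -- The determinant is multilinear in the rows, so its derivative is the sum over the rows of
    -- determinants with that row differentiated. Expanding along that row yields cofactors, i.e.
    -- det A times entries of A⁻¹.
    have hd := (ContinuousMultilinearMap.mk (Matrix.detRowAlternating
      (R := ℝ) (n := Fin k)).toMultilinearMap (by
        exact Continuous.matrix_det (A := fun M : Fin k → Fin k → ℝ => Matrix.of M)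
          continuous_id)).hasFDerivAt (A u)
    have hA' : HasFDerivAt (fun w => (fun a b => A w a b : Fin k → Fin k → ℝ))
        (ContinuousLinearMap.pi fun a => ContinuousLinearMap.pi fun b =>
          fderiv ℝ (fun w => A w a b) u) u := by
      rw [hasFDerivAt_pi]
      intro a
      rw [hasFDerivAt_pi]
      intro b
      exact (hA.differentiableAt a b).hasFDerivAt
    have := HasFDerivAt.comp u hd hA'
    have h2 : pderiv i (fun w => (A w).det) u = _ := congrArg
      (fun L => L (EuclideanSpace.single i 1)) this.fderiv
    exact h2.trans (ContinuousMultilinearMap.linearDeriv_apply _ _ _)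
  rw [key, Matrix.trace_mul_comm, Matrix.trace, Finset.mul_sum]
  refine Finset.sum_congr rfl fun a _ => ?_
  rw [Matrix.diag_apply, Matrix.mul_apply, Finset.mul_sum, 
    Matrix.det_eq_sum_mul_adjugate_row _ a]
  refine Finset.sum_congr rfl fun b _ => ?_
  have : (A u).det * (A u)⁻¹ b a = (A u).adjugate b a := by
    rw [Matrix.inv_def, Matrix.smul_apply, Ring.inverse_eq_inv', smul_eq_mul,
      mul_inv_cancel_left₀ h0]
  rw [mul_left_comm, this, Matrix.updateRow_self]
  simp [Matrix.adjugate_apply]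

end MatrixCalculus

/-! ### Tension fields in matrix form -/

section LocalTension

variable {m n : ℕ}
  {M : Type*} [TopologicalSpace M] [ChartedSpace (E m) M] [IsManifold (𝓡 m) ∞ M]
  {N : Type*} [TopologicalSpace N] [ChartedSpace (E n) N] [IsManifold (𝓡 n) ∞ N]

variable (n) in
/-- The Jacobian matrix of the local representative of `φ`. -/
def jacobian (φ : M → N) (p : M) (u : E m) : Matrix (Fin n) (Fin m) ℝ :=
  Matrix.of fun α i => dcoord φ p u α i

variable (n) in
/-- The matrix `g^{ij} ∂_j φ^α` of the gradients of the coordinates of `φ`. -/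
def coordGradients (g : SmoothMetric m M) (φ : M → N) (p : M) (u : E m) :
    Matrix (Fin m) (Fin n) ℝ :=
  (gram g p u)⁻¹ * (jacobian n φ p u).transpose

/-- The matrix of `h` along `φ`. -/
def targetGram (h : SmoothMetric n N) (φ : M → N) (p : M) (u : E m) : Matrix (Fin n) (Fin n) ℝ :=
  gram h (φ p) (localRep φ p u)

/-- The matrix of the Cauchy-Green tensor. -/
def cauchyGreenMatrix (g : SmoothMetric m M) (h : SmoothMetric n N) (φ : M → N) (p : M) (u : E m) :
    Matrix (Fin m) (Fin m) ℝ :=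
  Matrix.of (cauchyGreen g h φ p u)

theorem gram_isSymm (g : SmoothMetric m M) (p : M) (u : E m) : (gram g p u).IsSymm := by
  ext i j
  exact g.symm _ _ _

theorem gram_inv_isSymm (g : SmoothMetric m M) (p : M) (u : E m) : ((gram g p u)⁻¹).IsSymm := by
  rw [Matrix.IsSymm, Matrix.transpose_nonsing_inv, gram_isSymm g p u]

theorem cauchyGreenMatrix_eq (g : SmoothMetric m M) (h : SmoothMetric n N) (φ : M → N) (p : M)
    (u : E m) : cauchyGreenMatrix g h φ p u =
      coordGradients n g φ p u * targetGram h φ p u * jacobian n φ p u := by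
  have : cauchyGreenMatrix g h φ p u = (gram g p u)⁻¹ *
      ((jacobian n φ p u).transpose * (targetGram h φ p u * jacobian n φ p u)) := by
    ext k j
    simp only [Matrix.mul_apply, Matrix.transpose_apply, cauchyGreenMatrix, Matrix.of_apply,
      cauchyGreen, jacobian, targetGram]
    refine Finset.sum_congr rfl fun l _ => ?_
    congr 1
    refine Finset.sum_congr rfl fun α _ => ?_
    rw [Finset.mul_sum]
    exact Finset.sum_congr rfl fun β _ => by ring
  rw [this, coordGradients]
  simp only [Matrix.mul_assoc]

/-- The trace `g^{ij} (∇dφ)^α_{ij}` at `u`, in the chart at `p`. -/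
def localTension (g : SmoothMetric m M) (h : SmoothMetric n N) (φ : M → N) (p : M) (u : E m)
    (α : Fin n) : ℝ :=
  ∑ i, ∑ j, (gram g p u)⁻¹ i j * secondForm g h φ p u α i j

theorem tension_apply (g : SmoothMetric m M) (h : SmoothMetric n N) (φ : M → N) (p : M)
    (α : Fin n) :
    (show E n from tension g h φ p) α = localTension g h φ p (extChartAt (𝓡 m) p p) α := rfl

/-- The components of the `σ₂`-tension field at `u`, in the chart at `p`. -/
def localSigmaTwoTension (g : SmoothMetric m M) (h : SmoothMetric n N) (φ : M → N) (p : M)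
    (u : E m) (α : Fin n) : ℝ :=
  2 * (energyDensity g h φ p u * localTension g h φ p u α
        + ∑ k, dcoord φ p u α k * gradEnergyDensity g h φ p u k)
      - ∑ i, ∑ j, (gram g p u)⁻¹ i j *
          ∑ k, cauchyGreen g h φ p u k j * secondForm g h φ p u α i k
      - ∑ k, dcoord φ p u α k * divCauchyGreen g h φ p u k

/-- The algebra behind the contraction `g^{ij} Γ^k_{ij}`. -/
theorem sum_christoffel_algebra {d : ℕ} {I : Matrix (Fin d) (Fin d) ℝ} (hI : I.IsSymm)
    {P : Fin d → Matrix (Fin d) (Fin d) ℝ} (k : Fin d) :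
    ∑ i, ∑ j, I i j * ((1 / 2 : ℝ) * ∑ l, I k l * (P i j l + P j i l - P l i j))
      = ∑ i, (I * P i * I) i k - (1 / 2 : ℝ) * ∑ l, I l k * (I * P l).trace := by
  have hs : ∀ i j, I i j = I j i := fun i j => hI.apply j i
  have e1 : ∑ i, ∑ j, ∑ l, I i j * I k l * P i j l = ∑ i, (I * P i * I) i k := by
    refine Finset.sum_congr rfl fun i _ => ?_
    simp only [Matrix.mul_apply, Finset.sum_mul]
    rw [Finset.sum_comm]
    refine Finset.sum_congr rfl fun l _ => Finset.sum_congr rfl fun j _ => ?_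
    rw [hs k l]; ring
  have e2 : ∑ i, ∑ j, ∑ l, I i j * I k l * P j i l = ∑ i, (I * P i * I) i k := by
    rw [← e1, Finset.sum_comm]
    refine Finset.sum_congr rfl fun i _ => Finset.sum_congr rfl fun j _ =>
      Finset.sum_congr rfl fun l _ => ?_
    rw [hs j i]
  have e3 : ∑ i, ∑ j, ∑ l, I i j * I k l * P l i j = ∑ l, I l k * (I * P l).trace := by
    have : ∀ i, ∑ j, ∑ l, I i j * I k l * P l i j = ∑ l, ∑ j, I i j * I k l * P l i j :=
      fun i => Finset.sum_comm
    simp only [this]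
    rw [Finset.sum_comm]
    refine Finset.sum_congr rfl fun l _ => ?_
    simp only [Matrix.trace, Matrix.diag_apply, Matrix.mul_apply, Finset.mul_sum]
    rw [Finset.sum_comm]
    refine Finset.sum_congr rfl fun j _ => Finset.sum_congr rfl fun i _ => ?_
    rw [hs k l, hs i j]; ring
  rw [← e3]
  -- The first two Christoffel terms have equal contractions by the symmetry of I, which absorbs the
  -- factor 1/2.
  have e4 : ∑ i, (I * P i * I) i k = (1 / 2 : ℝ) * (∑ i, ∑ j, ∑ l, I i j * I k l * P i j l
      + ∑ i, ∑ j, ∑ l, I i j * I k l * P j i l) := by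
    rw [e1, e2]; ring
  rw [e4, ← mul_sub, ← Finset.sum_add_distrib, ← Finset.sum_sub_distrib, Finset.mul_sum]
  refine Finset.sum_congr rfl fun i _ => ?_
  rw [← Finset.sum_add_distrib, ← Finset.sum_sub_distrib, Finset.mul_sum]
  refine Finset.sum_congr rfl fun j _ => ?_
  rw [← Finset.sum_add_distrib, ← Finset.sum_sub_distrib, Finset.mul_sum, Finset.mul_sum,
    Finset.mul_sum]
  exact Finset.sum_congr rfl fun l _ => by ring

variable {g G : SmoothMetric m M} {h : SmoothMetric n N} {φ : M → N} {p : M} {u : E m}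

/-- This is the classical g^{ij} Γ^k_{ij} = -(det g)^(-1/2) ∂_i((det g)^(1/2) g^{ik}), with the
derivative of the density written as half a logarithmic derivative of det g so that no square root
occurs. -/
theorem sum_gram_inv_mul_christoffel (hg : MatSmoothAt (gram g p) u) (h0 : (gram g p u).det ≠ 0)
    (k : Fin m) :
    ∑ i, ∑ j, (gram g p u)⁻¹ i j * christoffel g p u k i j =
      - ∑ i, matPderiv i (fun w => (gram g p w)⁻¹) u i k
      - (1 / 2 : ℝ) * ∑ i, pderiv i (fun w => (gram g p w).det) u / (gram g p u).det *
        (gram g p u)⁻¹ i k := by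
  refine (sum_christoffel_algebra (gram_inv_isSymm g p u)
    (P := fun i => matPderiv i (gram g p) u) k).trans ?_
  congr 1
  · rw [← Finset.sum_neg_distrib]
    refine Finset.sum_congr rfl fun i _ => ?_
    rw [matPderiv_inv hg h0, Matrix.neg_apply, neg_neg]
  · congr 1
    refine Finset.sum_congr rfl fun i _ => ?_
    rw [pderiv_det hg h0, mul_div_cancel_left₀ _ h0, mul_comm]

/-- The tension field in divergence form. -/
theorem localTension_eq (hg : MatSmoothAt (gram g p) u) (h0 : (gram g p u).det ≠ 0)
    (hA : MatSmoothAt (jacobian n φ p) u) (α : Fin n) :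
    localTension g h φ p u α =
      ∑ i, matPderiv i (coordGradients n g φ p) u i α
      + (1 / 2 : ℝ) * ∑ i, pderiv i (fun w => (gram g p w).det) u / (gram g p u).det *
          coordGradients n g φ p u i α
      + ∑ i, ∑ β, ∑ γ, christoffel h (φ p) (localRep φ p u) α β γ * jacobian n φ p u β i *
          coordGradients n g φ p u i γ := by
  have hY : ∀ i γ, coordGradients n g φ p u i γ =
      ∑ j, (gram g p u)⁻¹ i j * dcoord φ p u γ j := fun i γ => rfl
  have hdY : ∀ i, matPderiv i (coordGradients n g φ p) u i α =
      ∑ j, matPderiv i (fun w => (gram g p w)⁻¹) u i j * dcoord φ p u α j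
      + ∑ j, (gram g p u)⁻¹ i j * pderiv i (fun w => dcoord φ p w α j) u := by
    intro i
    have := matPderiv_mul (hg.inv h0) hA.transpose i
    exact congrFun (congrFun this i) α
  have hΓ : ∑ i, ∑ j, (gram g p u)⁻¹ i j * ∑ k, christoffel g p u k i j * dcoord φ p u α k =
      ∑ k, (∑ i, ∑ j, (gram g p u)⁻¹ i j * christoffel g p u k i j) * dcoord φ p u α k := by
    simp only [Finset.mul_sum, Finset.sum_mul, ← mul_assoc]
    rw [Finset.sum_comm (s := (Finset.univ : Finset (Fin m)))
      (f := fun k i => ∑ j, (gram g p u)⁻¹ i j * christoffel g p u k i j * dcoord φ p u α k)]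
    exact Finset.sum_congr rfl fun i _ => Finset.sum_comm
  have hN : ∑ i, ∑ j, (gram g p u)⁻¹ i j * ∑ β, ∑ γ,
        christoffel h (φ p) (localRep φ p u) α β γ * dcoord φ p u β i * dcoord φ p u γ j =
      ∑ i, ∑ β, ∑ γ, christoffel h (φ p) (localRep φ p u) α β γ * jacobian n φ p u β i *
          coordGradients n g φ p u i γ := by
    refine Finset.sum_congr rfl fun i _ => ?_
    simp only [hY, Finset.mul_sum]
    rw [Finset.sum_comm]
    refine Finset.sum_congr rfl fun β _ => ?_
    rw [Finset.sum_comm]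
    refine Finset.sum_congr rfl fun γ _ => Finset.sum_congr rfl fun j _ => ?_
    simp only [jacobian, Matrix.of_apply]
    ring
  simp only [localTension, secondForm, mul_add, mul_sub, Finset.sum_add_distrib,
    Finset.sum_sub_distrib]
  rw [hN, hΓ]
  congr 1
  -- The contracted Christoffel symbols supply the derivative of g⁻¹ that the product rule for Y =
  -- g⁻¹Aᵗ requires, together with the density term.
  simp only [sum_gram_inv_mul_christoffel hg h0, hdY, hY, Finset.sum_add_distrib, sub_mul, neg_mul,
    Finset.sum_sub_distrib, Finset.sum_neg_distrib, Finset.mul_sum, Finset.sum_mul]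
  rw [Finset.sum_comm (f := fun k i => matPderiv i (fun w => (gram g p w)⁻¹) u i k *
    dcoord φ p u α k), Finset.sum_comm (f := fun k i => (1 / 2 : ℝ) *
      (pderiv i (fun w => (gram g p w).det) u / (gram g p u).det *
        (gram g p u)⁻¹ i k) * dcoord φ p u α k)]
  simp only [mul_assoc]
  ring

/-- The matrix of `(∇dφ)(∂_i, ·)`. -/
theorem secondForm_eq (g : SmoothMetric m M) (h : SmoothMetric n N) (φ : M → N) (p : M) (u : E m)
    (i : Fin m) :
    (Matrix.of fun α j => secondForm g h φ p u α i j) =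
      matPderiv i (jacobian n φ p) u
      - jacobian n φ p u * Matrix.of (fun l k => christoffel g p u l i k)
      + Matrix.of (fun α γ => ∑ β, christoffel h (φ p) (localRep φ p u) α β γ * dcoord φ p u β i)
        * jacobian n φ p u := by
  ext α j
  simp only [Matrix.add_apply, Matrix.sub_apply, Matrix.mul_apply, Matrix.of_apply, secondForm,
    jacobian, matPderiv_apply]
  congr 1
  · congr 1
    exact Finset.sum_congr rfl fun k _ => mul_comm _ _
  · rw [Finset.sum_comm]
    exact Finset.sum_congr rfl fun γ _ => (Finset.sum_mul _ _ _).symm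

/-- The Christoffel terms form a commutator ΓC - CΓ; multiplied by the Jacobian A, its first half
cancels the term -AΓC coming from (∇dφ) ∘ ℭ. -/
theorem covDerivCauchyGreen_eq (g : SmoothMetric m M) (h : SmoothMetric n N) (φ : M → N) (p : M)
    (u : E m) (i : Fin m) :
    (Matrix.of fun k j => covDerivCauchyGreen g h φ p u i k j) =
      matPderiv i (cauchyGreenMatrix g h φ p) u
      + Matrix.of (fun l k => christoffel g p u l i k) * cauchyGreenMatrix g h φ p u
      - cauchyGreenMatrix g h φ p u * Matrix.of (fun l k => christoffel g p u l i k) := by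
  ext k j
  simp only [Matrix.add_apply, Matrix.sub_apply, Matrix.mul_apply, Matrix.of_apply,
    covDerivCauchyGreen, cauchyGreenMatrix, matPderiv_apply]
  congr 1
  exact Finset.sum_congr rfl fun k _ => mul_comm _ _

theorem coordGradients_smoothAt (hg : MatSmoothAt (gram g p) u) (h0 : (gram g p u).det ≠ 0)
    (hA : MatSmoothAt (jacobian n φ p) u) : MatSmoothAt (coordGradients n g φ p) u :=
  (hg.inv h0).mul hA.transpose

/-- The product rule `(∇_i dφ) ∘ ℭ + dφ ∘ ∇_i ℭ = ∇_i (dφ ∘ ℭ)` for a horizontally conformal map,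
where `dφ ∘ ℭ = L dφ`. -/
theorem secondForm_mul_add_mul_covDeriv (hg : MatSmoothAt (gram g p) u)
    (h0 : (gram g p u).det ≠ 0) (hA : MatSmoothAt (jacobian n φ p) u)
    (hH : MatSmoothAt (targetGram h φ p) u) {L : E m → ℝ} (hL : ContDiffAt ℝ ∞ L u)
    (hc : ∀ᶠ w in nhds u, jacobian n φ p w * coordGradients n g φ p w * targetGram h φ p w =
      L w • (1 : Matrix (Fin n) (Fin n) ℝ)) (i : Fin m) :
    (Matrix.of fun α j => secondForm g h φ p u α i j) * cauchyGreenMatrix g h φ p u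
      + jacobian n φ p u * (Matrix.of fun k j => covDerivCauchyGreen g h φ p u i k j)
    = L u • (Matrix.of fun α j => secondForm g h φ p u α i j)
      + pderiv i L u • jacobian n φ p u := by
  have hCs : MatSmoothAt (cauchyGreenMatrix g h φ p) u := by
    rw [funext (cauchyGreenMatrix_eq g h φ p)]
    exact ((coordGradients_smoothAt hg h0 hA).mul hH).mul hA
  have hAC : ∀ᶠ w in nhds u, jacobian n φ p w * cauchyGreenMatrix g h φ p w
      = L w • jacobian n φ p w := by
    filter_upwards [hc] with w hw
    rw [cauchyGreenMatrix_eq, ← Matrix.mul_assoc, ← Matrix.mul_assoc, hw, Matrix.smul_mul,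
      Matrix.one_mul]
  have hd : matPderiv i (jacobian n φ p) u * cauchyGreenMatrix g h φ p u
      + jacobian n φ p u * matPderiv i (cauchyGreenMatrix g h φ p) u
      = pderiv i L u • jacobian n φ p u + L u • matPderiv i (jacobian n φ p) u := by
    rw [← matPderiv_mul hA hCs, matPderiv_congr hAC,
      matPderiv_smul (hL.differentiableAt (by simp)) hA]
  have hAC' := hAC.self_of_nhds
  rw [secondForm_eq, covDerivCauchyGreen_eq]
  set Γ : Matrix (Fin m) (Fin m) ℝ := Matrix.of (fun l k => christoffel g p u l i k)
  set Q : Matrix (Fin n) (Fin n) ℝ :=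
    Matrix.of (fun α γ => ∑ β, christoffel h (φ p) (localRep φ p u) α β γ * dcoord φ p u β i)
  generalize cauchyGreenMatrix g h φ p u = C at *
  generalize jacobian n φ p u = A at *
  simp only [Matrix.add_mul, Matrix.sub_mul, Matrix.mul_add, Matrix.mul_sub, smul_add, smul_sub]
  -- The terms ∓AΓC cancel, and AC = L A turns QAC and ACΓ into the terms of L ∇dφ; the rest is the
  -- ordinary product rule `hd`.
  rw [Matrix.mul_assoc Q, hAC', ← Matrix.mul_assoc A C Γ, hAC', Matrix.mul_smul, Matrix.smul_mul,
    Matrix.mul_assoc A Γ C]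
  rw [← sub_eq_zero] at hd ⊢
  rw [← hd]
  abel

/-- The `σ₂`-tension field of a horizontally conformal map. -/
theorem localSigmaTwoTension_eq (hg : MatSmoothAt (gram g p) u)
    (h0 : (gram g p u).det ≠ 0) (hA : MatSmoothAt (jacobian n φ p) u)
    (hH : MatSmoothAt (targetGram h φ p) u) {L : E m → ℝ} (hL : ContDiffAt ℝ ∞ L u)
    (hc : ∀ᶠ w in nhds u, jacobian n φ p w * coordGradients n g φ p w * targetGram h φ p w =
      L w • (1 : Matrix (Fin n) (Fin n) ℝ)) (α : Fin n) :
    localSigmaTwoTension g h φ p u α =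
      ((n : ℝ) - 1) * (L u * localTension g h φ p u α
        + ∑ i, pderiv i L u * coordGradients n g φ p u i α) := by
  have hLd : DifferentiableAt ℝ L u := hL.differentiableAt (by simp)
  -- Cyclicity of the trace: trace(Y H A) = trace(A Y H) = nL.
  have he : ∀ᶠ w in nhds u, energyDensity g h φ p w = (n : ℝ) / 2 * L w := by
    filter_upwards [hc] with w hw
    have : energyDensity g h φ p w = 1 / 2 * (cauchyGreenMatrix g h φ p w).trace := rfl
    rw [this, cauchyGreenMatrix_eq, Matrix.trace_mul_comm, ← Matrix.mul_assoc, hw,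
      Matrix.trace_smul, Matrix.trace_one, Fintype.card_fin, smul_eq_mul]
    ring
  have hde : ∀ l, pderiv l (energyDensity g h φ p) u = (n : ℝ) / 2 * pderiv l L u := fun l => by
    rw [pderiv_congr he, pderiv_const_mul hLd]
  have hgrad : ∑ k, dcoord φ p u α k * gradEnergyDensity g h φ p u k =
      (n : ℝ) / 2 * ∑ i, pderiv i L u * coordGradients n g φ p u i α := by
    simp only [gradEnergyDensity, hde, Finset.mul_sum]
    rw [Finset.sum_comm]
    refine Finset.sum_congr rfl fun l _ => ?_
    rw [coordGradients, Matrix.mul_apply, Finset.mul_sum, Finset.mul_sum]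
    refine Finset.sum_congr rfl fun k _ => ?_
    rw [(gram_inv_isSymm g p u).apply, Matrix.transpose_apply, jacobian, Matrix.of_apply]
    ring
  have hdiv : ∑ i, ∑ j, (gram g p u)⁻¹ i j *
          ∑ k, cauchyGreen g h φ p u k j * secondForm g h φ p u α i k
      + ∑ k, dcoord φ p u α k * divCauchyGreen g h φ p u k =
      L u * localTension g h φ p u α + ∑ i, pderiv i L u * coordGradients n g φ p u i α := by
    have key : ∀ i j, ∑ k, cauchyGreen g h φ p u k j * secondForm g h φ p u α i k
        + ∑ k, dcoord φ p u α k * covDerivCauchyGreen g h φ p u i k j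
        = L u * secondForm g h φ p u α i j + pderiv i L u * dcoord φ p u α j := by
      intro i j
      have := congrFun (congrFun (secondForm_mul_add_mul_covDeriv hg h0 hA hH hL hc i) α) j
      simp only [Matrix.add_apply, Matrix.mul_apply, Matrix.smul_apply, smul_eq_mul,
        Matrix.of_apply, cauchyGreenMatrix, jacobian] at this
      rw [← this]
      congr 1
      exact Finset.sum_congr rfl fun k _ => mul_comm _ _
    have h1 : ∑ k, dcoord φ p u α k * divCauchyGreen g h φ p u k =
        ∑ i, ∑ j, (gram g p u)⁻¹ i j *
          ∑ k, dcoord φ p u α k * covDerivCauchyGreen g h φ p u i k j := by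
      simp only [divCauchyGreen, Finset.mul_sum]
      rw [Finset.sum_comm]
      refine Finset.sum_congr rfl fun i _ => ?_
      rw [Finset.sum_comm]
      exact Finset.sum_congr rfl fun j _ => Finset.sum_congr rfl fun k _ => by ring
    rw [h1, localTension, Finset.mul_sum, ← Finset.sum_add_distrib, ← Finset.sum_add_distrib]
    refine Finset.sum_congr rfl fun i _ => ?_
    rw [coordGradients, Matrix.mul_apply, Finset.mul_sum, Finset.mul_sum, ← Finset.sum_add_distrib,
      ← Finset.sum_add_distrib]
    refine Finset.sum_congr rfl fun j _ => ?_
    rw [← mul_add, key, Matrix.transpose_apply, jacobian, Matrix.of_apply]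
    ring
  -- The energy part contributes n and the Cauchy-Green part 1 copy of Lτ + dφ(grad L), whence the
  -- factor n - 1.
  rw [localSigmaTwoTension, sub_sub, hdiv, hgrad, he.self_of_nhds]
  ring

/-- The tension fields with respect to two metrics `g` and `G` for which the gradients of the
coordinates of `φ` are proportional. -/
theorem localTension_related (hg : MatSmoothAt (gram g p) u) (h0 : (gram g p u).det ≠ 0)
    (hG : MatSmoothAt (gram G p) u) (hA : MatSmoothAt (jacobian n φ p) u)
    {s v : E m → ℝ} (hs : ContDiffAt ℝ ∞ s u) (hv : ContDiffAt ℝ ∞ v u) (hv0 : v u ≠ 0)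
    (hY : ∀ᶠ w in nhds u, coordGradients n G φ p w = s w • coordGradients n g φ p w)
    (hD : ∀ᶠ w in nhds u, (gram G p w).det = v w ^ 2 * (gram g p w).det) (α : Fin n) :
    localTension G h φ p u α = s u * localTension g h φ p u α
      + (v u)⁻¹ * ∑ i, pderiv i (fun w => v w * s w) u * coordGradients n g φ p u i α := by
  have hsd : DifferentiableAt ℝ s u := hs.differentiableAt (by simp)
  have hvd : DifferentiableAt ℝ v u := hv.differentiableAt (by simp)
  have hDd : DifferentiableAt ℝ (fun w => (gram g p w).det) u := hg.det.differentiableAt (by simp)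
  have hG0 : (gram G p u).det ≠ 0 := by
    rw [hD.self_of_nhds]
    exact mul_ne_zero (pow_ne_zero _ hv0) h0
  have e1 : ∀ i, matPderiv i (coordGradients n G φ p) u i α =
      pderiv i s u * coordGradients n g φ p u i α
        + s u * matPderiv i (coordGradients n g φ p) u i α := fun i => by
    rw [matPderiv_congr hY, matPderiv_smul hsd (coordGradients_smoothAt hg h0 hA)]
    rfl
  -- Here v is the ratio of the volume densities of G and g up to sign; half of this logarithmic
  -- derivative contributes ∂v/v.
  have e2 : ∀ i, pderiv i (fun w => (gram G p w).det) u / (gram G p u).det =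
      2 * pderiv i v u / v u + pderiv i (fun w => (gram g p w).det) u / (gram g p u).det := by
    intro i
    rw [pderiv_congr hD, hD.self_of_nhds, pderiv_mul (hvd.fun_pow 2) hDd]
    simp only [pow_two]
    rw [pderiv_mul hvd hvd]
    field_simp
    ring
  have e3 : ∀ i γ, coordGradients n G φ p u i γ = s u * coordGradients n g φ p u i γ := fun i γ => by
    rw [hY.self_of_nhds]
    rfl
  rw [localTension_eq hG hG0 hA, localTension_eq hg h0 hA]
  simp only [e1, e2, e3, pderiv_mul hvd hsd, Finset.mul_sum, mul_add]
  rw [← Finset.sum_add_distrib, ← Finset.sum_add_distrib, ← Finset.sum_add_distrib,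
    ← Finset.sum_add_distrib, ← Finset.sum_add_distrib]
  refine Finset.sum_congr rfl fun i _ => ?_
  have e4 : ∑ β, ∑ γ, christoffel h (φ p) (localRep φ p u) α β γ * jacobian n φ p u β i *
          (s u * coordGradients n g φ p u i γ) =
      ∑ β, ∑ γ, s u * (christoffel h (φ p) (localRep φ p u) α β γ * jacobian n φ p u β i *
          coordGradients n g φ p u i γ) :=
    Finset.sum_congr rfl fun β _ => Finset.sum_congr rfl fun γ _ => by ring
  rw [e4]
  field_simp
  ring

/-- The `σ_{1,2}`-tension field with respect to `G` of a map which is horizontally conformal with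
respect to `g`. -/
theorem localTension_add_localSigmaTwoTension (hg : MatSmoothAt (gram g p) u)
    (h0 : (gram g p u).det ≠ 0) (hG : MatSmoothAt (gram G p) u)
    (hA : MatSmoothAt (jacobian n φ p) u) (hH : MatSmoothAt (targetGram h φ p) u)
    {L s v : E m → ℝ} (hL : ContDiffAt ℝ ∞ L u) (hs : ContDiffAt ℝ ∞ s u)
    (hv : ContDiffAt ℝ ∞ v u) (hv0 : v u ≠ 0)
    (hc : ∀ᶠ w in nhds u, jacobian n φ p w * coordGradients n g φ p w * targetGram h φ p w =
      L w • (1 : Matrix (Fin n) (Fin n) ℝ))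
    (hY : ∀ᶠ w in nhds u, coordGradients n G φ p w = s w • coordGradients n g φ p w)
    (hD : ∀ᶠ w in nhds u, (gram G p w).det = v w ^ 2 * (gram g p w).det)
    {α : Fin n} (hτ : localTension g h φ p u α = 0) (a K : ℝ) :
    a * localTension G h φ p u α + K * localSigmaTwoTension G h φ p u α =
      (v u)⁻¹ * ∑ i, pderiv i
        (fun w => a * (v w * s w) + K * ((n : ℝ) - 1) * (v w * s w * (s w * L w))) u *
          coordGradients n g φ p u i α := by
  have hsd : DifferentiableAt ℝ s u := hs.differentiableAt (by simp)
  have hvd : DifferentiableAt ℝ v u := hv.differentiableAt (by simp)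
  have hLd : DifferentiableAt ℝ L u := hL.differentiableAt (by simp)
  have hG0 : (gram G p u).det ≠ 0 := by
    rw [hD.self_of_nhds]
    exact mul_ne_zero (pow_ne_zero _ hv0) h0
  -- With respect to G the map is again horizontally conformal, of squared dilation sL.
  have hc' : ∀ᶠ w in nhds u, jacobian n φ p w * coordGradients n G φ p w * targetGram h φ p w =
      (s w * L w) • (1 : Matrix (Fin n) (Fin n) ℝ) := by
    filter_upwards [hc, hY] with w h1 h2
    rw [h2, Matrix.mul_smul, Matrix.smul_mul, h1, smul_smul]
  have e3 : ∀ i γ, coordGradients n G φ p u i γ = s u * coordGradients n g φ p u i γ := fun i γ => by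
    rw [hY.self_of_nhds]
    rfl
  rw [localSigmaTwoTension_eq hG hG0 hA hH (hs.mul hL) hc',
    localTension_related hg h0 hG hA hs hv hv0 hY hD, hτ]
  -- Grouping the product as (vs)(sL) matches the two terms Lτ and dφ(grad L) of the σ₂-tension for
  -- the squared dilation sL.
  have e5 : ∀ i, pderiv i
      (fun w => a * (v w * s w) + K * ((n : ℝ) - 1) * (v w * s w * (s w * L w))) u =
      a * pderiv i (fun w => v w * s w) u + K * ((n : ℝ) - 1) *
        (pderiv i (fun w => v w * s w) u * (s u * L u)
          + v u * s u * pderiv i (fun w => s w * L w) u) := by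
    intro i
    have hvs : DifferentiableAt ℝ (fun w => v w * s w) u := hvd.mul hsd
    have hsL : DifferentiableAt ℝ (fun w => s w * L w) u := hsd.mul hLd
    rw [pderiv_add (hvs.const_mul a) ((hvs.fun_mul hsL).const_mul _), pderiv_const_mul hvs,
      pderiv_const_mul (hvs.fun_mul hsL), pderiv_mul hvs hsL]
  simp only [e3, e5, mul_zero, zero_add]
  simp only [Finset.mul_sum, mul_add]
  rw [← Finset.sum_add_distrib, ← Finset.sum_add_distrib]
  refine Finset.sum_congr rfl fun i _ => ?_
  field_simp

end LocalTension

/-! ### Coordinate vector fields -/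

section Coordinates

variable {d : ℕ} {M : Type*} [TopologicalSpace M] [ChartedSpace (E d) M] [IsManifold (𝓡 d) ∞ M]

theorem isManifold_one : IsManifold (𝓡 d) 1 M :=
  IsManifold.of_le (n := ∞) (by simp)

theorem contMDiffAt_extChartAt_symm (p : M) {u : E d} (hu : u ∈ (extChartAt (𝓡 d) p).target) :
    ContMDiffAt 𝓘(ℝ, E d) (𝓡 d) ∞ (extChartAt (𝓡 d) p).symm u :=
  (contMDiffOn_extChartAt_symm p).contMDiffAt ((isOpen_extChartAt_target p).mem_nhds hu)

theorem mfderiv_extChartAt_symm_isInvertible (p : M) {u : E d}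
    (hu : u ∈ (extChartAt (𝓡 d) p).target) :
    (mfderiv 𝓘(ℝ, E d) (𝓡 d) (extChartAt (𝓡 d) p).symm u).IsInvertible := by
  have := isManifold_one (d := d) (M := M)
  have h := isInvertible_mfderivWithin_extChartAt_symm hu
  rwa [ModelWithCorners.range_eq_univ, mfderivWithin_univ] at h

theorem mfderiv_extChartAt_symm_apply (p : M) (u c : E d) :
    mfderiv 𝓘(ℝ, E d) (𝓡 d) (extChartAt (𝓡 d) p).symm u c = ∑ i, c i • coordVec p u i := by
  have hc : c = ∑ i, c i • (EuclideanSpace.single i 1 : E d) := by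
    ext j
    simp [Finset.sum_apply, Pi.single_apply]
  set D : E d →L[ℝ] TangentSpace (𝓡 d) ((extChartAt (𝓡 d) p).symm u) :=
    mfderiv 𝓘(ℝ, E d) (𝓡 d) (extChartAt (𝓡 d) p).symm u
  have : D (∑ i, c i • (EuclideanSpace.single i 1 : E d)) =
      ∑ i, c i • D (EuclideanSpace.single i 1 : E d) := by
    rw [map_sum]
    exact Finset.sum_congr rfl fun i _ => D.map_smul _ _
  rw [← hc] at this
  exact this

theorem exists_eq_sum_coordVec (p : M) {u : E d} (hu : u ∈ (extChartAt (𝓡 d) p).target)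
    (X : TangentSpace (𝓡 d) ((extChartAt (𝓡 d) p).symm u)) :
    ∃ c : Fin d → ℝ, X = ∑ i, c i • coordVec p u i := by
  obtain ⟨c, hc⟩ := (mfderiv_extChartAt_symm_isInvertible p hu).bijective.surjective X
  exact ⟨fun i => (show E d from c) i, by rw [← hc]; exact mfderiv_extChartAt_symm_apply p u c⟩

theorem coordVec_coeff_eq_zero (p : M) {u : E d} (hu : u ∈ (extChartAt (𝓡 d) p).target)
    {c : Fin d → ℝ} (hc : ∑ i, c i • coordVec p u i = 0) : c = 0 := by
  have h := mfderiv_extChartAt_symm_apply p u (WithLp.toLp 2 c)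
  have h2 := (mfderiv_extChartAt_symm_isInvertible p hu).bijective.injective
    (a₁ := (WithLp.toLp 2 c : E d)) (a₂ := (0 : E d)) (by
      refine h.trans (hc.trans ?_)
      exact (map_zero _).symm)
  ext i
  exact congrArg (fun v : E d => v i) h2

/-- The sum `∑ c_i ∂_i` paired with another such sum. -/
theorem inner_sum_coordVec (g : SmoothMetric d M) (p : M) (u : E d) (c e : Fin d → ℝ) :
    g.inner _ (∑ i, c i • coordVec p u i) (∑ j, e j • coordVec p u j) =
      c ⬝ᵥ (gram g p u).mulVec e := by
  simp only [map_sum, ContinuousLinearMap.map_smul, sum_apply,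
    smul_apply, smul_eq_mul, dotProduct, Matrix.mulVec, Finset.mul_sum]
  rw [Finset.sum_comm]
  refine Finset.sum_congr rfl fun i _ => Finset.sum_congr rfl fun j _ => ?_
  simp only [gram, Matrix.of_apply]
  ring

/-- A kernel vector of the Gram matrix would give a tangent vector of zero length. -/
theorem gram_det_ne_zero (g : SmoothMetric d M) (p : M) {u : E d}
    (hu : u ∈ (extChartAt (𝓡 d) p).target) : (gram g p u).det ≠ 0 := by
  intro h
  obtain ⟨c, hc0, hc⟩ := Matrix.exists_mulVec_eq_zero_iff.2 h
  refine hc0 (coordVec_coeff_eq_zero p hu ?_)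
  refine metricForm_self_eq_zero g _ _ ?_
  rw [metricForm_apply, inner_sum_coordVec, hc, dotProduct_zero]

theorem gram_isUnit_det (g : SmoothMetric d M) (p : M) {u : E d}
    (hu : u ∈ (extChartAt (𝓡 d) p).target) : IsUnit (gram g p u).det :=
  isUnit_iff_ne_zero.2 (gram_det_ne_zero g p hu)

/-! ### Smooth sections and their coordinate components -/

section Smoothness

variable {F : Type*} [NormedAddCommGroup F] [NormedSpace ℝ F]

theorem contDiffAt_smul_const {f : E d → ℝ} {u : E d} (hf : ContDiffAt ℝ ∞ f u) (T : F) :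
    ContDiffAt ℝ ∞ (fun x => f x • T) u :=
  hf.smul contDiffAt_const

theorem contMDiffAt_iff_comp_extChartAt_symm {f : M → F} {p : M} :
    ContMDiffAt (𝓡 d) 𝓘(ℝ, F) ∞ f p ↔
      ContDiffAt ℝ ∞ (fun u => f ((extChartAt (𝓡 d) p).symm u)) (extChartAt (𝓡 d) p p) := by
  have hp := (extChartAt (𝓡 d) p).left_inv (mem_extChartAt_source p)
  constructor
  · intro hf
    rw [← contMDiffAt_iff_contDiffAt]
    refine ContMDiffAt.comp (I' := 𝓡 d) (g := f) _ ?_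
      (contMDiffAt_extChartAt_symm p (mem_extChartAt_target p))
    rwa [hp]
  · intro hf
    rw [← contMDiffAt_iff_contDiffAt] at hf
    have h1 : ContMDiffAt (𝓡 d) 𝓘(ℝ, F) ∞
        ((fun u => f ((extChartAt (𝓡 d) p).symm u)) ∘ extChartAt (𝓡 d) p) p :=
      ContMDiffAt.comp _ hf contMDiffAt_extChartAt
    refine h1.congr_of_eventuallyEq ?_
    filter_upwards [extChartAt_source_mem_nhds (I := 𝓡 d) p] with x hx
    simp only [Function.comp_apply, (extChartAt (𝓡 d) p).left_inv hx]

/-- The trivialization of a bundle of homomorphisms is composition with the trivializations of its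
factors; applied twice, both arguments are pulled back through the tangent bundle. -/
theorem bilin_trivializationAt_apply {p x : M} (hx : x ∈ (chartAt (E d) p).source)
    (B : TangentSpace (𝓡 d) x →L[ℝ] TangentSpace (𝓡 d) x →L[ℝ] ℝ) (v w : E d) :
    (trivializationAt (E d →L[ℝ] E d →L[ℝ] ℝ)
      (fun x : M => TangentSpace (𝓡 d) x →L[ℝ] TangentSpace (𝓡 d) x →L[ℝ] ℝ) p ⟨x, B⟩).2 v w =
    B ((trivializationAt (E d) (TangentSpace (𝓡 d)) p).symmL ℝ x v)
      ((trivializationAt (E d) (TangentSpace (𝓡 d)) p).symmL ℝ x w) := by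
  have := isManifold_one (d := d) (M := M)
  have hb : x ∈ (trivializationAt (E d →L[ℝ] ℝ)
      (fun x : M => TangentSpace (𝓡 d) x →L[ℝ] ℝ) p).baseSet := by
    simpa using hx
  simp only [hom_trivializationAt_apply, ContinuousLinearMap.inCoordinates,
    ContinuousLinearMap.comp_apply, Bundle.Trivialization.continuousLinearMapAt_apply]
  rw [Bundle.Trivialization.coe_linearMapAt_of_mem _ hb]
  simp [hom_trivializationAt_apply, ContinuousLinearMap.inCoordinates]

/-- The elementary bilinear form `v, w ↦ v_i w_j`. -/
def elementaryBilin (i j : Fin d) : E d →L[ℝ] E d →L[ℝ] ℝ :=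
  ContinuousLinearMap.smulRight (EuclideanSpace.proj i : E d →L[ℝ] ℝ)
    (EuclideanSpace.proj j : E d →L[ℝ] ℝ)

theorem eq_sum_elementaryBilin (T : E d →L[ℝ] E d →L[ℝ] ℝ) :
    T = ∑ i, ∑ j, T (EuclideanSpace.single i 1) (EuclideanSpace.single j 1) •
      elementaryBilin i j := by
  have hc : ∀ c : E d, c = ∑ i, c i • (EuclideanSpace.single i 1 : E d) := by
    intro c
    ext j
    simp [Finset.sum_apply, Pi.single_apply]
  have hp : ∀ (i : Fin d) (c : E d), (EuclideanSpace.proj i : E d →L[ℝ] ℝ) c = c i :=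
    fun _ _ => rfl
  ext v w
  conv_lhs => rw [hc v, hc w]
  simp only [map_sum, map_smul, sum_apply, smul_apply, smul_eq_mul, elementaryBilin,
    ContinuousLinearMap.smulRight_apply, hp, Finset.mul_sum]
  rw [Finset.sum_comm]
  refine Finset.sum_congr rfl fun i _ => Finset.sum_congr rfl fun j _ => ?_
  ring

/-- A section of the bundle of bilinear forms is smooth if and only if its components are. -/
theorem contMDiffAt_bilin_iff
    (B : ∀ x : M, TangentSpace (𝓡 d) x →L[ℝ] TangentSpace (𝓡 d) x →L[ℝ] ℝ) (p : M) :
    ContMDiffAt (𝓡 d) ((𝓡 d).prod 𝓘(ℝ, E d →L[ℝ] E d →L[ℝ] ℝ)) ∞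
      (fun x => Bundle.TotalSpace.mk' (E d →L[ℝ] E d →L[ℝ] ℝ)
        (E := fun x : M => TangentSpace (𝓡 d) x →L[ℝ] TangentSpace (𝓡 d) x →L[ℝ] ℝ) x (B x)) p ↔
    MatSmoothAt (fun u => (Matrix.of fun i j => B _ (coordVec p u i) (coordVec p u j) :
      Matrix (Fin d) (Fin d) ℝ)) (extChartAt (𝓡 d) p p) := by
  have := isManifold_one (d := d) (M := M)
  rw [Bundle.contMDiffAt_section, contMDiffAt_iff_comp_extChartAt_symm]
  set Φ : E d → (E d →L[ℝ] E d →L[ℝ] ℝ) := fun u => (trivializationAt (E d →L[ℝ] E d →L[ℝ] ℝ)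
    (fun x : M => TangentSpace (𝓡 d) x →L[ℝ] TangentSpace (𝓡 d) x →L[ℝ] ℝ) p
      ⟨(extChartAt (𝓡 d) p).symm u, B ((extChartAt (𝓡 d) p).symm u)⟩).2 with hΦ
  have key : ∀ u ∈ (extChartAt (𝓡 d) p).target, ∀ i j,
      Φ u (EuclideanSpace.single i 1) (EuclideanSpace.single j 1) =
        B _ (coordVec p u i) (coordVec p u j) := by
    intro u hu i j
    have hx : (extChartAt (𝓡 d) p).symm u ∈ (chartAt (E d) p).source := by
      rw [← extChartAt_source (𝓡 d)]
      exact (extChartAt (𝓡 d) p).map_target hu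
    -- The inverse trivialization of TM is the derivative of the inverse chart, which sends the
    -- standard basis to the coordinate fields.
    have hs := TangentBundle.symmL_trivializationAt (𝕜 := ℝ) (I := 𝓡 d) hx
    rw [ModelWithCorners.range_eq_univ, mfderivWithin_univ,
      (extChartAt (𝓡 d) p).right_inv hu] at hs
    have hv : ∀ i, (trivializationAt (E d) (TangentSpace (𝓡 d)) p).symmL ℝ
      ((extChartAt (𝓡 d) p).symm u) (EuclideanSpace.single i 1 : E d) = coordVec p u i :=
      fun i => by rw [hs]; rfl
    rw [← hv i, ← hv j]
    exact bilin_trivializationAt_apply hx _ _ _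
  have hnhds := (isOpen_extChartAt_target p).mem_nhds (mem_extChartAt_target (I := 𝓡 d) p)
  constructor
  · intro h i j
    refine ContDiffAt.congr_of_eventuallyEq (f := fun u => Φ u (EuclideanSpace.single i 1)
      (EuclideanSpace.single j 1)) ((h.clm_apply contDiffAt_const).clm_apply contDiffAt_const) ?_
    filter_upwards [hnhds] with u hu
    exact (key u hu i j).symm
  · intro h
    refine ContDiffAt.congr_of_eventuallyEq (f := fun u => ∑ i, ∑ j,
      (B _ (coordVec p u i) (coordVec p u j) : ℝ) • (elementaryBilin i j))
      (ContDiffAt.sum fun i _ => ContDiffAt.sum fun j _ => 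
        contDiffAt_smul_const (h i j) (elementaryBilin i j)) ?_
    filter_upwards [hnhds] with u hu
    refine (eq_sum_elementaryBilin (Φ u)).trans ?_
    exact Finset.sum_congr rfl fun i _ => Finset.sum_congr rfl fun j _ => by rw [key u hu]

theorem gram_smoothAt (g : SmoothMetric d M) (p : M) :
    MatSmoothAt (gram g p) (extChartAt (𝓡 d) p p) :=
  (contMDiffAt_bilin_iff g.inner p).1 (g.contMDiff p)

end Smoothness

end Coordinates

/-! ### Maps in coordinates -/

section MapCoordinates

variable {m n : ℕ}
  {M : Type*} [TopologicalSpace M] [ChartedSpace (E m) M] [IsManifold (𝓡 m) ∞ M]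
  {N : Type*} [TopologicalSpace N] [ChartedSpace (E n) N] [IsManifold (𝓡 n) ∞ N]
  {g : SmoothMetric m M} {h : SmoothMetric n N} {φ : M → N} {p : M} {u : E m}

variable (n) in
/-- The coordinates `u` of the points where the local representative of `φ` is meaningful. -/
def localDomain (φ : M → N) (p : M) : Set (E m) :=
  {u | u ∈ (extChartAt (𝓡 m) p).target ∧
    φ ((extChartAt (𝓡 m) p).symm u) ∈ (extChartAt (𝓡 n) (φ p)).source}

theorem extChartAt_mem_localDomain (φ : M → N) (p : M) :
    extChartAt (𝓡 m) p p ∈ localDomain n φ p := by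
  refine ⟨mem_extChartAt_target p, ?_⟩
  rw [(extChartAt (𝓡 m) p).left_inv (mem_extChartAt_source p)]
  exact mem_extChartAt_source _

theorem localDomain_mem_nhds (hφ : ContMDiff (𝓡 m) (𝓡 n) ∞ φ) (hu : u ∈ localDomain n φ p) :
    localDomain n φ p ∈ nhds u := by
  have h1 : ContinuousAt (fun w => φ ((extChartAt (𝓡 m) p).symm w)) u :=
    ContinuousAt.comp (g := φ) hφ.continuous.continuousAt
      (contMDiffAt_extChartAt_symm p hu.1).continuousAt
  filter_upwards [(isOpen_extChartAt_target p).mem_nhds hu.1,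
    h1 ((isOpen_extChartAt_source (φ p)).mem_nhds hu.2)] with w hw hw'
  exact ⟨hw, hw'⟩

theorem localRep_mem_target (hu : u ∈ localDomain n φ p) :
    localRep φ p u ∈ (extChartAt (𝓡 n) (φ p)).target :=
  (extChartAt (𝓡 n) (φ p)).map_source hu.2

theorem symm_localRep (hu : u ∈ localDomain n φ p) :
    (extChartAt (𝓡 n) (φ p)).symm (localRep φ p u) = φ ((extChartAt (𝓡 m) p).symm u) :=
  (extChartAt (𝓡 n) (φ p)).left_inv hu.2

theorem localRep_contDiffAt (hφ : ContMDiff (𝓡 m) (𝓡 n) ∞ φ) (hu : u ∈ localDomain n φ p) :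
    ContDiffAt ℝ ∞ (localRep φ p : E m → E n) u := by
  rw [← contMDiffAt_iff_contDiffAt]
  have h2 : ContMDiffAt (𝓡 n) 𝓘(ℝ, E n) ∞ (extChartAt (𝓡 n) (φ p))
      (φ ((extChartAt (𝓡 m) p).symm u)) :=
    contMDiffAt_extChartAt' (by rw [← extChartAt_source (𝓡 n)]; exact hu.2)
  exact ContMDiffAt.comp (g := extChartAt (𝓡 n) (φ p)) _ h2
    (ContMDiffAt.comp (g := φ) _ hφ.contMDiffAt (contMDiffAt_extChartAt_symm p hu.1))

theorem localRep_apply_contDiffAt (hφ : ContMDiff (𝓡 m) (𝓡 n) ∞ φ) (hu : u ∈ localDomain n φ p)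
    (α : Fin n) : ContDiffAt ℝ ∞ (fun w => localRep φ p w α) u :=
  (EuclideanSpace.proj α : E n →L[ℝ] ℝ).contDiff.contDiffAt.comp _ (localRep_contDiffAt hφ hu)

theorem jacobian_smoothAt (hφ : ContMDiff (𝓡 m) (𝓡 n) ∞ φ) (hu : u ∈ localDomain n φ p) :
    MatSmoothAt (jacobian n φ p) u := fun α i =>
  ((localRep_apply_contDiffAt hφ hu α).fderiv_right (m := ∞) (by simp)).clm_apply contDiffAt_const

theorem fderiv_localRep_single (hφ : ContMDiff (𝓡 m) (𝓡 n) ∞ φ) (hu : u ∈ localDomain n φ p)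
    (i : Fin m) : fderiv ℝ (localRep φ p : E m → E n) u (EuclideanSpace.single i 1) =
      WithLp.toLp 2 fun α => jacobian n φ p u α i := by
  ext α
  have h1 := ((localRep_contDiffAt hφ hu).differentiableAt (by simp)).hasFDerivAt
  have h2 := (EuclideanSpace.proj α : E n →L[ℝ] ℝ).hasFDerivAt.comp u h1
  exact (congrArg (fun T => T (EuclideanSpace.single i 1)) h2.fderiv).symm

/-- `dφ(∂_i) = ∂_i φ^α ∂_α`, in the model space `ℝ^n`. -/
theorem mfderiv_coordVec (hφ : ContMDiff (𝓡 m) (𝓡 n) ∞ φ) (hu : u ∈ localDomain n φ p)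
    (i : Fin m) :
    (mfderiv (𝓡 m) (𝓡 n) φ ((extChartAt (𝓡 m) p).symm u) (coordVec p u i) : E n) =
      (∑ α, jacobian n φ p u α i • coordVec (φ p) (localRep φ p u) α :
        TangentSpace (𝓡 n) ((extChartAt (𝓡 n) (φ p)).symm (localRep φ p u))) := by
  have h1 : HasMFDerivAt 𝓘(ℝ, E m) (𝓡 n) (φ ∘ (extChartAt (𝓡 m) p).symm) u _ :=
    HasMFDerivAt.comp u
      (hφ.mdifferentiable (by simp) ((extChartAt (𝓡 m) p).symm u)).hasMFDerivAt
      ((contMDiffAt_extChartAt_symm p hu.1).mdifferentiableAt (by simp)).hasMFDerivAt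
  have h2 : HasMFDerivAt 𝓘(ℝ, E m) (𝓡 n)
      ((extChartAt (𝓡 n) (φ p)).symm ∘ (localRep φ p : E m → E n)) u _ :=
    HasMFDerivAt.comp (I' := 𝓘(ℝ, E n)) u
      ((contMDiffAt_extChartAt_symm (φ p) (localRep_mem_target hu)).mdifferentiableAt
        (by simp)).hasMFDerivAt
      ((localRep_contDiffAt hφ hu).differentiableAt (by simp)).hasFDerivAt.hasMFDerivAt
  -- One map factors in two ways near u; the chain rule for both factorizations gives the formula.
  -- The vectors are compared in `E n` because their base points are only propositionally equal.
  have h3 : (φ ∘ (extChartAt (𝓡 m) p).symm) =ᶠ[nhds u]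
      ((extChartAt (𝓡 n) (φ p)).symm ∘ (localRep φ p : E m → E n)) := by
    filter_upwards [localDomain_mem_nhds hφ hu] with w hw
    exact (symm_localRep hw).symm
  have h4 := hasMFDerivAt_unique h1 (h2.congr_of_eventuallyEq h3)
  have h5 := congrArg (fun T : E m →L[ℝ] E n => T (EuclideanSpace.single i 1)) h4
  refine h5.trans ?_
  refine (congrArg (mfderiv 𝓘(ℝ, E n) (𝓡 n) (extChartAt (𝓡 n) (φ p)).symm (localRep φ p u))
    (fderiv_localRep_single hφ hu i)).trans ?_
  exact mfderiv_extChartAt_symm_apply (φ p) (localRep φ p u) _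

theorem mfderiv_sum_coordVec (hφ : ContMDiff (𝓡 m) (𝓡 n) ∞ φ) (hu : u ∈ localDomain n φ p)
    (c : Fin m → ℝ) :
    (mfderiv (𝓡 m) (𝓡 n) φ ((extChartAt (𝓡 m) p).symm u) (∑ i, c i • coordVec p u i) : E n) =
      (∑ α, (jacobian n φ p u).mulVec c α • coordVec (φ p) (localRep φ p u) α :
        TangentSpace (𝓡 n) ((extChartAt (𝓡 n) (φ p)).symm (localRep φ p u))) := by
  have h1 : mfderiv (𝓡 m) (𝓡 n) φ ((extChartAt (𝓡 m) p).symm u) (∑ i, c i • coordVec p u i) =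
      ∑ i, c i • mfderiv (𝓡 m) (𝓡 n) φ ((extChartAt (𝓡 m) p).symm u) (coordVec p u i) := by
    rw [map_sum]
    exact Finset.sum_congr rfl fun i _ => ContinuousLinearMap.map_smul _ _ _
  refine h1.trans ?_
  have h2 : ∀ i, mfderiv (𝓡 m) (𝓡 n) φ ((extChartAt (𝓡 m) p).symm u) (coordVec p u i) = _ :=
    fun i => mfderiv_coordVec hφ hu i
  have h3 : (∑ i, c i • (∑ α, jacobian n φ p u α i • coordVec (φ p) (localRep φ p u) α :
      TangentSpace (𝓡 n) ((extChartAt (𝓡 n) (φ p)).symm (localRep φ p u)))) =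
      ∑ α, (jacobian n φ p u).mulVec c α • coordVec (φ p) (localRep φ p u) α := by
    simp only [Finset.smul_sum, smul_smul, Matrix.mulVec, dotProduct, Finset.sum_smul]
    rw [Finset.sum_comm]
    exact Finset.sum_congr rfl fun α _ => Finset.sum_congr rfl fun i _ => by rw [mul_comm]
  refine Eq.trans ?_ h3
  exact Finset.sum_congr rfl fun i _ => congrArg (fun v : E n => c i • v) (h2 i)

/-- All tangent spaces of N are definitionally `E n`, so the metric can be moved between equal base
points without transporting vectors. -/
theorem inner_cast (h : SmoothMetric n N) {y y' : N} (hy : y = y') (v w : E n) :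
    h.inner y v w = h.inner y' v w := by
  subst hy
  rfl

theorem inner_mfderiv_sum_coordVec (hφ : ContMDiff (𝓡 m) (𝓡 n) ∞ φ) (hu : u ∈ localDomain n φ p)
    (c e : Fin m → ℝ) :
    h.inner (φ ((extChartAt (𝓡 m) p).symm u))
      (mfderiv (𝓡 m) (𝓡 n) φ ((extChartAt (𝓡 m) p).symm u) (∑ i, c i • coordVec p u i))
      (mfderiv (𝓡 m) (𝓡 n) φ ((extChartAt (𝓡 m) p).symm u) (∑ i, e i • coordVec p u i)) =
    (jacobian n φ p u).mulVec c ⬝ᵥ (targetGram h φ p u).mulVec ((jacobian n φ p u).mulVec e) := by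
  refine (inner_cast h (symm_localRep hu).symm _ _).trans ?_
  refine (congrArg₂ (fun v w : E n => h.inner
    ((extChartAt (𝓡 n) (φ p)).symm (localRep φ p u)) v w)
    (mfderiv_sum_coordVec hφ hu c) (mfderiv_sum_coordVec hφ hu e)).trans ?_
  exact inner_sum_coordVec h (φ p) (localRep φ p u) _ _

theorem sum_single_smul_coordVec (p : M) (u : E m) (i : Fin m) :
    ∑ k, (Pi.single i 1 : Fin m → ℝ) k • coordVec p u k = coordVec p u i := by
  rw [Finset.sum_eq_single i]
  · rw [Pi.single_eq_same]
    exact one_smul ℝ _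
  · intro b _ hb
    rw [Pi.single_eq_of_ne hb]
    exact zero_smul ℝ _
  · simp

theorem inner_mfderiv_coordVec (hφ : ContMDiff (𝓡 m) (𝓡 n) ∞ φ) (hu : u ∈ localDomain n φ p)
    (i j : Fin m) :
    h.inner (φ ((extChartAt (𝓡 m) p).symm u))
      (mfderiv (𝓡 m) (𝓡 n) φ ((extChartAt (𝓡 m) p).symm u) (coordVec p u i))
      (mfderiv (𝓡 m) (𝓡 n) φ ((extChartAt (𝓡 m) p).symm u) (coordVec p u j)) =
    ((jacobian n φ p u).transpose * targetGram h φ p u * jacobian n φ p u) i j := by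
  have := inner_mfderiv_sum_coordVec (h := h) hφ hu (Pi.single i 1) (Pi.single j 1)
  rw [sum_single_smul_coordVec, sum_single_smul_coordVec] at this
  rw [this, Matrix.mulVec_single_one, Matrix.mulVec_single_one, Matrix.mul_assoc, Matrix.mul_apply]
  simp only [dotProduct, Matrix.mulVec, Matrix.mul_apply]
  rfl

theorem targetGram_isSymm (h : SmoothMetric n N) (φ : M → N) (p : M) (u : E m) :
    (targetGram h φ p u).IsSymm := gram_isSymm _ _ _

theorem targetGram_smoothAt (hφ : ContMDiff (𝓡 m) (𝓡 n) ∞ φ) (h : SmoothMetric n N) (p : M) :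
    MatSmoothAt (targetGram h φ p) (extChartAt (𝓡 m) p p) := by
  have h1 := gram_smoothAt h (φ p)
  have h2 : extChartAt (𝓡 n) (φ p) (φ p) = localRep φ p (extChartAt (𝓡 m) p p) := by
    rw [localRep, (extChartAt (𝓡 m) p).left_inv (mem_extChartAt_source p)]
  rw [h2] at h1
  exact fun α β => (h1 α β).comp _ (localRep_contDiffAt hφ (extChartAt_mem_localDomain φ p))

/-- The pullback `φ^*h`. -/
def pullbackForm (h : SmoothMetric n N) (φ : M → N) (x : M) :
    TangentSpace (𝓡 m) x →L[ℝ] TangentSpace (𝓡 m) x →L[ℝ] ℝ :=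
  ContinuousLinearMap.bilinearComp (E := E n) (F := E n) (G := ℝ) (E' := E m) (F' := E m)
    (h.inner (φ x)) (mfderiv (𝓡 m) (𝓡 n) φ x) (mfderiv (𝓡 m) (𝓡 n) φ x)

theorem pullbackForm_apply (h : SmoothMetric n N) (φ : M → N) (x : M)
    (v w : TangentSpace (𝓡 m) x) : pullbackForm h φ x v w =
      h.inner (φ x) (mfderiv (𝓡 m) (𝓡 n) φ x v) (mfderiv (𝓡 m) (𝓡 n) φ x w) := rfl

end MapCoordinates

/-! ### Horizontally conformal maps -/

section Conformal

variable {m n : ℕ}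
  {M : Type*} [TopologicalSpace M] [ChartedSpace (E m) M] [IsManifold (𝓡 m) ∞ M]
  {N : Type*} [TopologicalSpace N] [ChartedSpace (E n) N] [IsManifold (𝓡 n) ∞ N]
  {g : SmoothMetric m M} {h : SmoothMetric n N} {φ : M → N} {lam : M → ℝ} {p : M} {u : E m}

theorem horizontalProj_add_verticalProj (g : SmoothMetric m M) (φ : M → N) (x : M)
    (v : TangentSpace (𝓡 m) x) : horizontalProj n g φ x v + verticalProj n g φ x v = v := by
  exact Submodule.projection_add_projection_eq_self (isCompl_horizontal_vertical n g φ x) v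

theorem horizontalProj_mem (g : SmoothMetric m M) (φ : M → N) (x : M)
    (v : TangentSpace (𝓡 m) x) : horizontalProj n g φ x v ∈ horizontal n g φ x :=
  Submodule.projection_apply_mem _ v

theorem verticalProj_mem (g : SmoothMetric m M) (φ : M → N) (x : M)
    (v : TangentSpace (𝓡 m) x) : verticalProj n g φ x v ∈ vertical n φ x :=
  Submodule.projection_apply_mem _ v

theorem mfderiv_horizontalProj (g : SmoothMetric m M) (φ : M → N) (x : M)
    (v : TangentSpace (𝓡 m) x) :
    mfderiv (𝓡 m) (𝓡 n) φ x (horizontalProj n g φ x v) = mfderiv (𝓡 m) (𝓡 n) φ x v := by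
  have h1 : mfderiv (𝓡 m) (𝓡 n) φ x (verticalProj n g φ x v) = 0 := verticalProj_mem g φ x v
  conv_rhs => rw [← horizontalProj_add_verticalProj (n := n) g φ x v]
  rw [map_add, h1, add_zero]

theorem inner_horizontal_vertical {x : M} {v w : TangentSpace (𝓡 m) x}
    (hv : v ∈ horizontal n g φ x) (hw : w ∈ vertical n φ x) : g.inner x v w = 0 := by
  rw [g.symm]
  exact hv w hw

theorem inner_eq_horizontal_add_vertical (g : SmoothMetric m M) (φ : M → N) (x : M)
    (v w : TangentSpace (𝓡 m) x) : g.inner x v w =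
      g.inner x (horizontalProj n g φ x v) (horizontalProj n g φ x w)
      + g.inner x (verticalProj n g φ x v) (verticalProj n g φ x w) := by
  conv_lhs => rw [← horizontalProj_add_verticalProj (n := n) g φ x v,
    ← horizontalProj_add_verticalProj (n := n) g φ x w]
  have h1 := inner_horizontal_vertical (horizontalProj_mem (n := n) g φ x v)
    (verticalProj_mem (n := n) g φ x w)
  have h2 := inner_horizontal_vertical (horizontalProj_mem (n := n) g φ x w)
    (verticalProj_mem (n := n) g φ x v)
  rw [g.symm] at h2
  rw [map_add, map_add, add_apply, add_apply, h1, h2]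
  ring

/-- A horizontal vector killed by dφ is also vertical, hence orthogonal to itself. This turns
equations dφ(grad f) = 0 into statements about horizontal gradients. -/
theorem horizontalProj_eq_zero_iff (g : SmoothMetric m M) (φ : M → N) (x : M)
    (v : TangentSpace (𝓡 m) x) :
    horizontalProj n g φ x v = 0 ↔ mfderiv (𝓡 m) (𝓡 n) φ x v = 0 := by
  constructor
  · intro hv
    rw [← mfderiv_horizontalProj g, hv, map_zero]
  · intro hv
    refine metricForm_self_eq_zero g x _ ?_
    refine inner_horizontal_vertical (n := n) (φ := φ) (horizontalProj_mem g φ x v) ?_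
    exact (mfderiv_horizontalProj g φ x v).trans hv

/-- Since dφ sees only horizontal parts, φ^*h is λ² g^ℋ; adding multiples of it to g rescales the
horizontal part alone. -/
theorem pullbackForm_eq (hφ : IsHorizontallyConformal g h φ lam) (x : M)
    (v w : TangentSpace (𝓡 m) x) : pullbackForm h φ x v w =
      lam x ^ 2 * g.inner x (horizontalProj n g φ x v) (horizontalProj n g φ x w) := by
  rw [pullbackForm_apply, ← mfderiv_horizontalProj g φ x v, ← mfderiv_horizontalProj g φ x w]
  exact hφ.conformal x _ (horizontalProj_mem g φ x v) _ (horizontalProj_mem g φ x w)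

theorem mfderiv_sum_coordVec_eq_zero_iff (hφ : ContMDiff (𝓡 m) (𝓡 n) ∞ φ)
    (hu : u ∈ localDomain n φ p) (c : Fin m → ℝ) :
    mfderiv (𝓡 m) (𝓡 n) φ ((extChartAt (𝓡 m) p).symm u) (∑ i, c i • coordVec p u i) = 0 ↔
      (jacobian n φ p u).mulVec c = 0 := by
  have h1 := mfderiv_sum_coordVec hφ hu c
  constructor
  · intro h0
    exact coordVec_coeff_eq_zero (φ p) (localRep_mem_target hu) (h1.symm.trans h0)
  · intro h0
    refine h1.trans ?_
    rw [h0]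
    simp only [Pi.zero_apply, zero_smul]
    exact Finset.sum_const_zero

theorem targetGram_isUnit_det (h : SmoothMetric n N) (hu : u ∈ localDomain n φ p) :
    IsUnit (targetGram h φ p u).det :=
  gram_isUnit_det h (φ p) (localRep_mem_target hu)

/-- Horizontal lifting: surjectivity of dφ gives some preimage, and its horizontal part has the same
image. -/
theorem exists_horizontal_mulVec_eq (hφ : IsHorizontallyConformal g h φ lam)
    (hu : u ∈ localDomain n φ p) (ε : Fin n → ℝ) :
    ∃ e : Fin m → ℝ, (jacobian n φ p u).mulVec e = ε ∧
      ∑ i, e i • coordVec p u i ∈ horizontal n g φ ((extChartAt (𝓡 m) p).symm u) := by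
  set x := (extChartAt (𝓡 m) p).symm u
  obtain ⟨X, hX⟩ := hφ.surjective x (∑ α, ε α • coordVec (φ p) (localRep φ p u) α :
    TangentSpace (𝓡 n) ((extChartAt (𝓡 n) (φ p)).symm (localRep φ p u)))
  obtain ⟨e, he⟩ := exists_eq_sum_coordVec p hu.1 (horizontalProj n g φ x X)
  refine ⟨e, ?_, by rw [← he]; exact horizontalProj_mem g φ x X⟩
  have h1 := mfderiv_sum_coordVec hφ.smooth hu e
  rw [← he] at h1
  have h2 := (h1.symm.trans (mfderiv_horizontalProj g φ x X)).trans hX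
  rw [← sub_eq_zero]
  refine coordVec_coeff_eq_zero (φ p) (localRep_mem_target hu) ?_
  simp only [Pi.sub_apply, sub_smul, Finset.sum_sub_distrib]
  exact sub_eq_zero.2 h2

/-- Horizontal conformality in coordinates: `g^{ij} ∂_i φ^α ∂_j φ^γ h_{γβ} = λ² δ^α_β`. -/
theorem jacobian_mul_coordGradients (hφ : IsHorizontallyConformal g h φ lam)
    (hu : u ∈ localDomain n φ p) :
    jacobian n φ p u * coordGradients n g φ p u * targetGram h φ p u =
      (lam ((extChartAt (𝓡 m) p).symm u) ^ 2) • (1 : Matrix (Fin n) (Fin n) ℝ) := by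
  set x := (extChartAt (𝓡 m) p).symm u with hx
  set A := jacobian n φ p u with hA
  set H := targetGram h φ p u with hH
  -- B is the matrix of the adjoint dφᵗ, as `hin` expresses. Its image is orthogonal to ker dφ,
  -- hence horizontal.
  set B := coordGradients n g φ p u * H with hB
  have hHs : H.transpose = H := targetGram_isSymm h φ p u
  have hBg : B.transpose * gram g p u = H * A := by
    rw [hB, coordGradients, Matrix.transpose_mul, Matrix.transpose_mul, Matrix.transpose_transpose,
      gram_inv_isSymm, hHs, Matrix.mul_assoc, Matrix.mul_assoc,
      Matrix.nonsing_inv_mul _ (gram_isUnit_det g p hu.1), Matrix.mul_one]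
  have hin : ∀ (δ : Fin n → ℝ) (e : Fin m → ℝ),
      g.inner x (∑ i, B.mulVec δ i • coordVec p u i) (∑ i, e i • coordVec p u i) =
        H.mulVec δ ⬝ᵥ A.mulVec e := by
    intro δ e
    rw [inner_sum_coordVec, ← Matrix.vecMul_transpose, ← Matrix.dotProduct_mulVec,
      Matrix.mulVec_mulVec, hBg, ← Matrix.mulVec_mulVec, Matrix.dotProduct_mulVec,
      ← Matrix.mulVec_transpose, hHs]
  have hhor : ∀ δ : Fin n → ℝ, ∑ i, B.mulVec δ i • coordVec p u i ∈ horizontal n g φ x := by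
    intro δ X hX
    obtain ⟨e, rfl⟩ := exists_eq_sum_coordVec p hu.1 X
    have h0 : A.mulVec e = 0 := (mfderiv_sum_coordVec_eq_zero_iff hφ.smooth hu e).1 hX
    have h1 := hin δ e
    rw [h0, dotProduct_zero, g.symm] at h1
    exact h1
  -- With e a horizontal lift of ε, h(dφ dφᵗδ, ε) = λ² g(dφᵗδ, e) = λ² h(δ, ε); the nondegeneracy of
  -- H then gives dφ dφᵗ = λ².
  have hkey : ∀ δ ε : Fin n → ℝ,
      H.mulVec (A.mulVec (B.mulVec δ)) ⬝ᵥ ε = (lam x ^ 2 • H.mulVec δ) ⬝ᵥ ε := by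
    intro δ ε
    obtain ⟨e, he, hehor⟩ := exists_horizontal_mulVec_eq hφ hu ε
    have h1 := hφ.conformal x _ (hhor δ) _ hehor
    rw [hin, inner_mfderiv_sum_coordVec hφ.smooth hu, he] at h1
    rw [smul_dotProduct, smul_eq_mul, ← h1, Matrix.dotProduct_mulVec, ← Matrix.mulVec_transpose]
    exact congrArg (fun Q : Matrix (Fin n) (Fin n) ℝ => Q.mulVec _ ⬝ᵥ ε) hHs.symm
  have hmat : H * (A * B) = lam x ^ 2 • H := by
    refine Matrix.ext_of_mulVec_single fun β => ?_
    refine dotProduct_eq _ _ fun ε => ?_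
    rw [← Matrix.mulVec_mulVec, ← Matrix.mulVec_mulVec, hkey, Matrix.smul_mulVec]
  have hHu := targetGram_isUnit_det h hu
  have := congrArg (fun Q => H⁻¹ * Q) hmat
  simp only [Matrix.mul_smul] at this
  rw [← Matrix.mul_assoc, Matrix.nonsing_inv_mul _ hHu, Matrix.one_mul] at this
  rw [Matrix.mul_assoc, this]

/-- The squared dilation is smooth in coordinates. -/
theorem sq_dilation_contDiffAt (hn : 0 < n) (hφ : IsHorizontallyConformal g h φ lam) (p : M) :
    ContDiffAt ℝ ∞ (fun u => lam ((extChartAt (𝓡 m) p).symm u) ^ 2) (extChartAt (𝓡 m) p p) := by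
  have hu := extChartAt_mem_localDomain (m := m) (n := n) φ p
  have h1 := (((jacobian_smoothAt hφ.smooth hu).mul (coordGradients_smoothAt (gram_smoothAt g p)
    (gram_det_ne_zero g p hu.1) (jacobian_smoothAt hφ.smooth hu))).mul
    -- The function λ² is read off a diagonal entry of A Y H = λ² 1, which exists because n ≥ 1.
    (targetGram_smoothAt hφ.smooth h p)) ⟨0, hn⟩ ⟨0, hn⟩
  refine h1.congr_of_eventuallyEq ?_
  filter_upwards [localDomain_mem_nhds hφ.smooth hu] with w hw
  rw [jacobian_mul_coordGradients hφ hw, Matrix.smul_apply, Matrix.one_apply_eq, smul_eq_mul,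
    mul_one]

theorem dilation_contMDiff (hn : 0 < n) (hφ : IsHorizontallyConformal g h φ lam) :
    ContMDiff (𝓡 m) 𝓘(ℝ, ℝ) ∞ lam := by
  intro p
  rw [contMDiffAt_iff_comp_extChartAt_symm]
  refine ((sq_dilation_contDiffAt hn hφ p).sqrt (pow_ne_zero 2 (hφ.pos _).ne')).congr_of_eventuallyEq
    (Filter.Eventually.of_forall fun u => ?_)
  exact (Real.sqrt_sq (hφ.pos _).le).symm

theorem eq_gram_inv_mulVec (g : SmoothMetric m M) (hu : u ∈ (extChartAt (𝓡 m) p).target)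
    {c e : Fin m → ℝ} (hc : (gram g p u).mulVec c = e) : c = (gram g p u)⁻¹.mulVec e := by
  rw [← hc, Matrix.mulVec_mulVec, Matrix.nonsing_inv_mul _ (gram_isUnit_det g p hu),
    Matrix.one_mulVec]

theorem mfderiv_apply_coordVec {f : M → ℝ} (hu : u ∈ (extChartAt (𝓡 m) p).target)
    (hf : MDifferentiableAt (𝓡 m) 𝓘(ℝ, ℝ) f ((extChartAt (𝓡 m) p).symm u)) (i : Fin m) :
    mfderiv (𝓡 m) 𝓘(ℝ, ℝ) f ((extChartAt (𝓡 m) p).symm u) (coordVec p u i) =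
      pderiv i (fun w => f ((extChartAt (𝓡 m) p).symm w)) u := by
  have h1 : HasMFDerivAt 𝓘(ℝ, E m) 𝓘(ℝ, ℝ) (f ∘ (extChartAt (𝓡 m) p).symm) u _ :=
    HasMFDerivAt.comp u hf.hasMFDerivAt
      ((contMDiffAt_extChartAt_symm p hu).mdifferentiableAt (by simp)).hasMFDerivAt
  have h2 : fderiv ℝ (f ∘ (extChartAt (𝓡 m) p).symm : E m → ℝ) u = _ :=
    mfderiv_eq_fderiv.symm.trans h1.mfderiv
  exact (congrArg (fun T : E m →L[ℝ] ℝ => T (EuclideanSpace.single i 1)) h2).symm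

theorem inner_gradient (g : SmoothMetric m M) (f : M → ℝ) (x : M) (w : TangentSpace (𝓡 m) x) :
    g.inner x (gradient g f x) w = mfderiv (𝓡 m) 𝓘(ℝ, ℝ) f x w := by
  have := LinearMap.BilinForm.apply_toDual_symm_apply (B := metricForm g x)
    (hB := metricForm_nondegenerate g x)
    (mfderiv (𝓡 m) 𝓘(ℝ, ℝ) f x : TangentSpace (𝓡 m) x →L[ℝ] ℝ).toLinearMap w
  exact this

/-- The horizontal gradient in coordinates. -/
theorem horizontalGradient_symm_eq_zero_iff (hφ : ContMDiff (𝓡 m) (𝓡 n) ∞ φ)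
    (hu : u ∈ localDomain n φ p) {f : M → ℝ}
    (hf : MDifferentiableAt (𝓡 m) 𝓘(ℝ, ℝ) f ((extChartAt (𝓡 m) p).symm u)) :
    horizontalGradient n g φ f ((extChartAt (𝓡 m) p).symm u) = 0 ↔
      ∀ α, ∑ i, pderiv i (fun w => f ((extChartAt (𝓡 m) p).symm w)) u *
        coordGradients n g φ p u i α = 0 := by
  set x := (extChartAt (𝓡 m) p).symm u
  obtain ⟨c, hc⟩ := exists_eq_sum_coordVec p hu.1 (gradient g f x)
  have h1 : (gram g p u).mulVec c =
      fun i => pderiv i (fun w => f ((extChartAt (𝓡 m) p).symm w)) u := by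
    ext i
    have h2 := inner_gradient g f x (coordVec p u i)
    rw [mfderiv_apply_coordVec hu.1 hf, g.symm, hc] at h2
    rw [← h2, ← sum_single_smul_coordVec p u i, inner_sum_coordVec]
    simp
  have h3 := eq_gram_inv_mulVec g hu.1 h1
  -- The horizontal part of grad f vanishes iff dφ(grad f) does, and the components of the latter
  -- are ∂_i f Y^{iα}.
  rw [horizontalGradient, horizontalProj_eq_zero_iff, hc, mfderiv_sum_coordVec_eq_zero_iff hφ hu,
    funext_iff]
  refine forall_congr' fun α => ?_
  have h4 : (jacobian n φ p u).mulVec c α = ∑ i, pderiv i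
      (fun w => f ((extChartAt (𝓡 m) p).symm w)) u * coordGradients n g φ p u i α := by
    rw [h3, Matrix.mulVec_mulVec]
    have : jacobian n φ p u * (gram g p u)⁻¹ = (coordGradients n g φ p u).transpose := by
      rw [coordGradients, Matrix.transpose_mul, Matrix.transpose_transpose, gram_inv_isSymm]
    rw [this, Matrix.mulVec_transpose]
    rfl
  rw [h4, Pi.zero_apply]

theorem horizontalGradient_eq_zero_iff (hφ : ContMDiff (𝓡 m) (𝓡 n) ∞ φ) {f : M → ℝ}
    (hf : MDifferentiableAt (𝓡 m) 𝓘(ℝ, ℝ) f p) :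
    horizontalGradient n g φ f p = 0 ↔
      ∀ α, ∑ i, pderiv i (fun w => f ((extChartAt (𝓡 m) p).symm w)) (extChartAt (𝓡 m) p p) *
        coordGradients n g φ p (extChartAt (𝓡 m) p p) i α = 0 := by
  have hp := (extChartAt (𝓡 m) p).left_inv (mem_extChartAt_source p)
  rw [← horizontalGradient_symm_eq_zero_iff hφ (extChartAt_mem_localDomain φ p) (by rwa [hp]), hp]

end Conformal

/-! ### Related metrics -/

section RelatedMetrics

variable {m n : ℕ}
  {M : Type*} [TopologicalSpace M] [ChartedSpace (E m) M] [IsManifold (𝓡 m) ∞ M]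
  {N : Type*} [TopologicalSpace N] [ChartedSpace (E n) N] [IsManifold (𝓡 n) ∞ N]
  {g G : SmoothMetric m M} {h : SmoothMetric n N} {φ : M → N} {lam c e : M → ℝ} {p : M} {u : E m}

/-- The unit ball of B lies in the unit ball of g scaled by k^(-1/2). -/
theorem isVonNBounded_of_le (g : SmoothMetric m M) (x : M)
    (B : TangentSpace (𝓡 m) x →L[ℝ] TangentSpace (𝓡 m) x →L[ℝ] ℝ) {k : ℝ} (hk : 0 < k)
    (hB : ∀ v, k * g.inner x v v ≤ B v v) :
    Bornology.IsVonNBounded ℝ {v : TangentSpace (𝓡 m) x | B v v < 1} := by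
  have hb : Bornology.IsVonNBounded ℝ ({v | g.inner x v v < 1} : Set (E m)) := g.isVonNBounded x
  have hs := Real.sqrt_pos.2 hk
  have h2 := hb.image ((Real.sqrt k)⁻¹ • ContinuousLinearMap.id ℝ (E m))
  refine Bornology.IsVonNBounded.subset ?_ h2
  intro v hv
  refine ⟨Real.sqrt k • v, ?_, ?_⟩
  · have h3 : g.inner x (Real.sqrt k • v) (Real.sqrt k • v) = k * g.inner x v v := by
      rw [map_smul, map_smul, smul_apply, smul_eq_mul, smul_eq_mul, ← mul_assoc,
        Real.mul_self_sqrt hk.le]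
    exact (h3.trans_le (hB v)).trans_lt hv
  · exact inv_smul_smul₀ (ne_of_gt hs) v

/-- The metric `c g + e φ^*h`. -/
def IsRelatedMetric (g : SmoothMetric m M) (h : SmoothMetric n N) (φ : M → N) (c e : M → ℝ)
    (G : SmoothMetric m M) : Prop :=
  ∀ x (v w : TangentSpace (𝓡 m) x),
    G.inner x v w = c x * g.inner x v w + e x * pullbackForm h φ x v w

theorem contDiffAt_comp_extChartAt_symm {f : M → ℝ} (hf : ContMDiff (𝓡 m) 𝓘(ℝ, ℝ) ∞ f) (p : M) :
    ContDiffAt ℝ ∞ (fun u => f ((extChartAt (𝓡 m) p).symm u)) (extChartAt (𝓡 m) p p) :=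
  contMDiffAt_iff_comp_extChartAt_symm.1 (hf p)

/-- The form is c g on 𝒱 and (c + eλ²) g on ℋ, so it dominates the smaller factor times g; this
gives positivity and boundedness of the unit balls. Smoothness holds because its matrix is c g + e
AᵗHA. -/
theorem exists_isRelatedMetric (hφ : IsHorizontallyConformal g h φ lam)
    (hc : ContMDiff (𝓡 m) 𝓘(ℝ, ℝ) ∞ c) (he : ContMDiff (𝓡 m) 𝓘(ℝ, ℝ) ∞ e)
    (hc0 : ∀ x, 0 < c x) (hce : ∀ x, 0 < c x + e x * lam x ^ 2) :
    ∃ G, IsRelatedMetric g h φ c e G := by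
  let B : ∀ x : M, TangentSpace (𝓡 m) x →L[ℝ] TangentSpace (𝓡 m) x →L[ℝ] ℝ :=
    fun x => c x • g.inner x + e x • pullbackForm h φ x
  have hB : ∀ x (v w : TangentSpace (𝓡 m) x),
      B x v w = c x * g.inner x v w + e x * pullbackForm h φ x v w := fun x v w => rfl
  have hle : ∀ x (v : TangentSpace (𝓡 m) x),
      min (c x) (c x + e x * lam x ^ 2) * g.inner x v v ≤ B x v v := by
    intro x v
    rw [hB, pullbackForm_eq hφ, inner_eq_horizontal_add_vertical (n := n) g φ x v v]
    have h0 : ∀ w : TangentSpace (𝓡 m) x, 0 ≤ g.inner x w w := by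
      intro w
      by_cases hw : w = 0
      · simp [hw]
      · exact (g.pos x w hw).le
    have h1 := mul_le_mul_of_nonneg_right (min_le_left (c x) (c x + e x * lam x ^ 2))
      (h0 (verticalProj n g φ x v))
    have h2 := mul_le_mul_of_nonneg_right (min_le_right (c x) (c x + e x * lam x ^ 2))
      (h0 (horizontalProj n g φ x v))
    linarith
  have hk : ∀ x, 0 < min (c x) (c x + e x * lam x ^ 2) := fun x => lt_min (hc0 x) (hce x)
  refine ⟨⟨B, ?_, ?_, fun x => isVonNBounded_of_le g x (B x) (hk x) (hle x), ?_⟩, hB⟩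
  · intro x v w
    rw [hB, hB, g.symm, pullbackForm_apply, pullbackForm_apply, h.symm]
  · intro x v hv
    exact (mul_pos (hk x) (g.pos x v hv)).trans_le (hle x v)
  · intro p
    rw [contMDiffAt_bilin_iff]
    have hu := extChartAt_mem_localDomain (m := m) (n := n) φ p
    have hA := jacobian_smoothAt hφ.smooth hu
    have h1 := ((gram_smoothAt g p).smul (contDiffAt_comp_extChartAt_symm hc p)).add
      (((hA.transpose.mul (targetGram_smoothAt hφ.smooth h p)).mul hA).smul
        (contDiffAt_comp_extChartAt_symm he p))
    refine h1.congr ?_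
    filter_upwards [localDomain_mem_nhds hφ.smooth hu] with w hw
    ext i j
    rw [Matrix.of_apply, hB, pullbackForm_apply, inner_mfderiv_coordVec hφ.smooth hw]
    rfl

theorem gram_relatedMetric (hφ : ContMDiff (𝓡 m) (𝓡 n) ∞ φ) (hG : IsRelatedMetric g h φ c e G)
    (hu : u ∈ localDomain n φ p) :
    gram G p u = c ((extChartAt (𝓡 m) p).symm u) • gram g p u
      + e ((extChartAt (𝓡 m) p).symm u) •
        ((jacobian n φ p u).transpose * targetGram h φ p u * jacobian n φ p u) := by
  ext i j
  have h1 : gram G p u i j = _ := hG _ (coordVec p u i) (coordVec p u j)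
  rw [h1, pullbackForm_apply, inner_mfderiv_coordVec hφ hu]
  rfl

/-- For square matrices a one-sided inverse is two-sided, so the factor H may be moved to the front.
-/
theorem targetGram_mul_jacobian_mul_coordGradients (hφ : IsHorizontallyConformal g h φ lam)
    (hu : u ∈ localDomain n φ p) :
    targetGram h φ p u * (jacobian n φ p u * coordGradients n g φ p u) =
      lam ((extChartAt (𝓡 m) p).symm u) ^ 2 • (1 : Matrix (Fin n) (Fin n) ℝ) := by
  have hl := (pow_pos (hφ.pos ((extChartAt (𝓡 m) p).symm u)) 2).ne'
  have h1 : ((lam ((extChartAt (𝓡 m) p).symm u) ^ 2)⁻¹ •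
      (jacobian n φ p u * coordGradients n g φ p u)) * targetGram h φ p u = 1 := by
    rw [Matrix.smul_mul, jacobian_mul_coordGradients hφ hu, smul_smul, inv_mul_cancel₀ hl, one_smul]
  have h2 := mul_eq_one_comm.1 h1
  rw [Matrix.mul_smul] at h2
  rw [← h2, smul_smul, mul_inv_cancel₀ hl, one_smul]

theorem gram_mul_coordGradients (g : SmoothMetric m M) (φ : M → N)
    (hu : u ∈ (extChartAt (𝓡 m) p).target) :
    gram g p u * coordGradients n g φ p u = (jacobian n φ p u).transpose := by
  rw [coordGradients, ← Matrix.mul_assoc, Matrix.mul_nonsing_inv _ (gram_isUnit_det g p hu),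
    Matrix.one_mul]

/-- Horizontal conformality gives G Y = (c + eλ²) Aᵗ; now invert G. -/
theorem coordGradients_relatedMetric (hφ : IsHorizontallyConformal g h φ lam)
    (hG : IsRelatedMetric g h φ c e G) (hce : ∀ x, 0 < c x + e x * lam x ^ 2)
    (hu : u ∈ localDomain n φ p) :
    coordGradients n G φ p u =
      (c ((extChartAt (𝓡 m) p).symm u) + e ((extChartAt (𝓡 m) p).symm u) *
        lam ((extChartAt (𝓡 m) p).symm u) ^ 2)⁻¹ • coordGradients n g φ p u := by
  have hgr := gram_relatedMetric hφ.smooth hG hu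
  have hs := hce ((extChartAt (𝓡 m) p).symm u)
  set x := (extChartAt (𝓡 m) p).symm u
  have hgY := gram_mul_coordGradients (n := n) g φ hu.1
  have h2 := targetGram_mul_jacobian_mul_coordGradients hφ hu
  have h5 : gram G p u * coordGradients n g φ p u =
      (c x + e x * lam x ^ 2) • (jacobian n φ p u).transpose := by
    rw [hgr, Matrix.add_mul, Matrix.smul_mul, Matrix.smul_mul, hgY, Matrix.mul_assoc,
      Matrix.mul_assoc, h2, Matrix.mul_smul, Matrix.mul_one, smul_smul, ← add_smul]
  have h6 : (jacobian n φ p u).transpose =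
      (c x + e x * lam x ^ 2)⁻¹ • (gram G p u * coordGradients n g φ p u) := by
    rw [h5, smul_smul, inv_mul_cancel₀ hs.ne', one_smul]
  rw [coordGradients, h6, Matrix.mul_smul, ← Matrix.mul_assoc,
    Matrix.nonsing_inv_mul _ (gram_isUnit_det G p hu.1), Matrix.one_mul]

/-- Factoring out c g leaves 1 + Y(e/c)HA, and det(1 + XZ) = det(1 + ZX) reduces this to an n × n
determinant of a scalar matrix. The result reflects m - n vertical and n horizontal directions. -/
theorem det_gram_relatedMetric (hnm : n ≤ m) (hφ : IsHorizontallyConformal g h φ lam)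
    (hG : IsRelatedMetric g h φ c e G) (hc0 : ∀ x, 0 < c x) (hu : u ∈ localDomain n φ p) :
    (gram G p u).det =
      c ((extChartAt (𝓡 m) p).symm u) ^ (m - n) * (c ((extChartAt (𝓡 m) p).symm u)
        + e ((extChartAt (𝓡 m) p).symm u) * lam ((extChartAt (𝓡 m) p).symm u) ^ 2) ^ n *
      (gram g p u).det := by
  have hgr := gram_relatedMetric hφ.smooth hG hu
  have hs := (hc0 ((extChartAt (𝓡 m) p).symm u)).ne'
  set x := (extChartAt (𝓡 m) p).symm u
  have hgY := gram_mul_coordGradients (n := n) g φ hu.1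
  have h2 : gram G p u = gram g p u * (c x • (1 + coordGradients n g φ p u *
      ((e x / c x) • (targetGram h φ p u * jacobian n φ p u)))) := by
    rw [hgr, ← hgY]
    simp only [Matrix.mul_smul, Matrix.mul_add, Matrix.mul_one, smul_add, smul_smul,
      Matrix.mul_assoc, mul_div_cancel₀ _ hs]
  have h3 : (1 + coordGradients n g φ p u *
      ((e x / c x) • (targetGram h φ p u * jacobian n φ p u))).det =
      (1 + e x / c x * lam x ^ 2) ^ n := by
    rw [Matrix.det_one_add_mul_comm, Matrix.smul_mul]
    rw [Matrix.mul_assoc, targetGram_mul_jacobian_mul_coordGradients hφ hu, smul_smul]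
    have h5 : (1 : Matrix (Fin n) (Fin n) ℝ) + (e x / c x * lam x ^ 2) • 1 =
        (1 + e x / c x * lam x ^ 2) • 1 := by rw [add_smul, one_smul]
    rw [h5, Matrix.det_smul, Matrix.det_one, mul_one, Fintype.card_fin]
  rw [h2, Matrix.det_mul, Matrix.det_smul, h3, Fintype.card_fin, mul_comm]
  congr 1
  obtain ⟨k, rfl⟩ := Nat.exists_eq_add_of_le hnm
  rw [Nat.add_sub_cancel_left, add_comm n k, pow_add, mul_assoc, ← mul_pow]
  congr 2
  field_simp

/-- The Euler-Lagrange operators of a submersive harmonic morphism with respect to a metric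
related to `g`, in terms of a horizontal gradient. -/
theorem tension_add_sigmaTwoTension_eq_zero_iff (hn : 0 < n) (hnm : n ≤ m)
    (hφ : IsSubmersiveHarmonicMorphism g h φ lam) (hG : IsRelatedMetric g h φ c e G)
    (hc : ContMDiff (𝓡 m) 𝓘(ℝ, ℝ) ∞ c) (he : ContMDiff (𝓡 m) 𝓘(ℝ, ℝ) ∞ e)
    (hc0 : ∀ x, 0 < c x) (hce : ∀ x, 0 < c x + e x * lam x ^ 2) {v f : M → ℝ}
    (hv : ContMDiff (𝓡 m) 𝓘(ℝ, ℝ) ∞ v) (hv0 : ∀ x, 0 < v x)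
    (hv2 : ∀ x, v x ^ 2 = c x ^ (m - n) * (c x + e x * lam x ^ 2) ^ n) (a K : ℝ)
    (hf : ∀ x, f x = a * (v x / (c x + e x * lam x ^ 2)) +
      K * ((n : ℝ) - 1) * (v x * lam x ^ 2 / (c x + e x * lam x ^ 2) ^ 2)) :
    a • tension G h φ p + K • sigmaTwoTension G h φ p = 0 ↔
      horizontalGradient n g φ f p = 0 := by
  have hφc := hφ.toIsHorizontallyConformal
  have hlam := dilation_contMDiff hn hφc
  have hu := extChartAt_mem_localDomain (m := m) (n := n) φ p
  have hcu := contDiffAt_comp_extChartAt_symm hc p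
  have heu := contDiffAt_comp_extChartAt_symm he p
  have hlu := contDiffAt_comp_extChartAt_symm hlam p
  have hvu := contDiffAt_comp_extChartAt_symm hv p
  have hsu : ContDiffAt ℝ ∞ (fun w => (c ((extChartAt (𝓡 m) p).symm w)
      + e ((extChartAt (𝓡 m) p).symm w) * lam ((extChartAt (𝓡 m) p).symm w) ^ 2)⁻¹)
      (extChartAt (𝓡 m) p p) := (hcu.add (heu.mul (hlu.pow 2))).inv (hce _).ne'
  have hf' : (fun w => f ((extChartAt (𝓡 m) p).symm w)) = fun w =>
      a * (v ((extChartAt (𝓡 m) p).symm w) * (c ((extChartAt (𝓡 m) p).symm w)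
        + e ((extChartAt (𝓡 m) p).symm w) * lam ((extChartAt (𝓡 m) p).symm w) ^ 2)⁻¹)
      + K * ((n : ℝ) - 1) * (v ((extChartAt (𝓡 m) p).symm w) * (c ((extChartAt (𝓡 m) p).symm w)
        + e ((extChartAt (𝓡 m) p).symm w) * lam ((extChartAt (𝓡 m) p).symm w) ^ 2)⁻¹ *
        ((c ((extChartAt (𝓡 m) p).symm w)
        + e ((extChartAt (𝓡 m) p).symm w) * lam ((extChartAt (𝓡 m) p).symm w) ^ 2)⁻¹ *
        lam ((extChartAt (𝓡 m) p).symm w) ^ 2)) := by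
    ext w
    rw [hf]
    have := (hce ((extChartAt (𝓡 m) p).symm w)).ne'
    field_simp
  have hfs : ContMDiffAt (𝓡 m) 𝓘(ℝ, ℝ) ∞ f p := by
    rw [contMDiffAt_iff_comp_extChartAt_symm, hf']
    exact (contDiffAt_const.mul (hvu.mul hsu)).add
      (contDiffAt_const.mul ((hvu.mul hsu).mul (hsu.mul (hlu.pow 2))))
  rw [horizontalGradient_eq_zero_iff hφc.smooth (hfs.mdifferentiableAt (by simp)), hf']
  have hev := localDomain_mem_nhds hφc.smooth hu
  have hτ : ∀ α, localTension g h φ p (extChartAt (𝓡 m) p p) α = 0 := fun α => by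
    rw [← tension_apply, hφ.harmonic p]
    rfl
  -- The parameter a covers both problems: a = 1 is the σ_{1,2} equation, while a = 0, K = 1 is the
  -- σ₂ equation.
  have key : ∀ α, (show E n from a • tension G h φ p + K • sigmaTwoTension G h φ p) α = _ :=
    fun α => localTension_add_localSigmaTwoTension (gram_smoothAt g p)
      (gram_det_ne_zero g p hu.1) (gram_smoothAt G p) (jacobian_smoothAt hφc.smooth hu)
      (targetGram_smoothAt hφc.smooth h p) (hlu.pow 2) hsu hvu (hv0 _).ne'
      (Filter.eventually_of_mem hev fun w hw => jacobian_mul_coordGradients hφc hw)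
      (Filter.eventually_of_mem hev fun w hw => coordGradients_relatedMetric hφc hG hce hw)
      (Filter.eventually_of_mem hev fun w hw => by
        rw [hv2]; exact det_gram_relatedMetric hnm hφc hG hc0 hw) (hτ α) a K
  constructor
  · intro h0 α
    have h1 := (congrArg (fun z : E n => z α) h0).symm.trans (key α)
    exact ((mul_eq_zero.1 h1.symm).resolve_left (inv_ne_zero (hv0 _).ne'))
  · intro h0
    refine (WithLp.ofLp_injective 2) (funext fun α => ?_)
    exact (key α).trans (mul_eq_zero_of_right _ (h0 α))

end RelatedMetrics

/-! ### The three families of metrics -/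

section Criteria

variable {m n : ℕ}
  {M : Type*} [TopologicalSpace M] [ChartedSpace (E m) M] [IsManifold (𝓡 m) ∞ M]
  {N : Type*} [TopologicalSpace N] [ChartedSpace (E n) N] [IsManifold (𝓡 n) ∞ N]
  {g G : SmoothMetric m M} {h : SmoothMetric n N} {φ : M → N} {lam : M → ℝ}

theorem horizontalGradient_const (hφ : ContMDiff (𝓡 m) (𝓡 n) ∞ φ) (r : ℝ) (p : M) :
    horizontalGradient n g φ (fun _ => r) p = 0 := by
  rw [horizontalGradient_eq_zero_iff hφ mdifferentiableAt_const]
  simp [pderiv_const]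

theorem contMDiff_rpow {f : M → ℝ} (hf : ContMDiff (𝓡 m) 𝓘(ℝ, ℝ) ∞ f) (hf0 : ∀ x, 0 < f x)
    (r : ℝ) : ContMDiff (𝓡 m) 𝓘(ℝ, ℝ) ∞ fun x => f x ^ r := fun p =>
  contMDiffAt_iff_comp_extChartAt_symm.2
    ((contDiffAt_comp_extChartAt_symm hf p).rpow_const_of_ne (hf0 _).ne')

theorem contMDiff_inv {f : M → ℝ} (hf : ContMDiff (𝓡 m) 𝓘(ℝ, ℝ) ∞ f) (hf0 : ∀ x, 0 < f x) :
    ContMDiff (𝓡 m) 𝓘(ℝ, ℝ) ∞ fun x => (f x)⁻¹ := fun p =>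
  contMDiffAt_iff_comp_extChartAt_symm.2 ((contDiffAt_comp_extChartAt_symm hf p).inv (hf0 _).ne')

/-- For ρ = 1/λ the horizontal factor is λ², and the vertical exponent makes the volume ratio v
equal to λ² as well. Both terms of f are then constant, whatever K is. -/
theorem exists_biconformal_critical (hn : 0 < n) (hnm : n < m)
    (hφ : IsSubmersiveHarmonicMorphism g h φ lam) :
    ∃ G : SmoothMetric m M, IsBiconformalMetric n g φ (fun x => 1 / lam x) G ∧
      ∀ K : ℝ, IsSigmaOneTwoCritical K G h φ := by
  have hφc := hφ.toIsHorizontallyConformal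
  have hlam := dilation_contMDiff hn hφc
  have hρ : ContMDiff (𝓡 m) 𝓘(ℝ, ℝ) ∞ fun x => 1 / lam x := by
    simpa only [one_div] using contMDiff_inv hlam hφc.pos
  have hρ0 : ∀ x, 0 < 1 / lam x := fun x => one_div_pos.2 (hφc.pos x)
  set r : ℝ := (2 * (n : ℝ) - 4) / ((m : ℝ) - (n : ℝ)) with hr
  set c : M → ℝ := fun x => (1 / lam x) ^ r with hcdef
  have hc : ContMDiff (𝓡 m) 𝓘(ℝ, ℝ) ∞ c := contMDiff_rpow hρ hρ0 r
  have hc0 : ∀ x, 0 < c x := fun x => Real.rpow_pos_of_pos (hρ0 x) r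
  -- The solution of c + eλ² = λ².
  set e : M → ℝ := fun x => 1 - c x * (1 / lam x) ^ 2 with hedef
  have he : ContMDiff (𝓡 m) 𝓘(ℝ, ℝ) ∞ e := contMDiff_const.sub (hc.mul (hρ.pow 2))
  have hce : ∀ x, c x + e x * lam x ^ 2 = lam x ^ 2 := by
    intro x
    have := (hφc.pos x).ne'
    simp only [hedef]
    field_simp
    ring
  have hce0 : ∀ x, 0 < c x + e x * lam x ^ 2 := fun x => by
    rw [hce]; exact pow_pos (hφc.pos x) 2
  obtain ⟨G, hG⟩ := exists_isRelatedMetric hφc hc he hc0 hce0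
  refine ⟨G, ⟨hρ, hρ0, fun x v w => ?_⟩, fun K p => ?_⟩
  · rw [hG, pullbackForm_eq hφc, inner_eq_horizontal_add_vertical (n := n) g φ x v w]
    have h1 : (1 / lam x) ^ (-2 : ℤ) = lam x ^ 2 := by
      rw [one_div, inv_zpow', neg_neg]
      norm_cast
    rw [h1]
    linear_combination (g.inner x (horizontalProj n g φ x v) (horizontalProj n g φ x w)) * hce x
  · rw [← one_smul ℝ (tension G h φ p), tension_add_sigmaTwoTension_eq_zero_iff hn hnm.le hφ hG hc he
      hc0 hce0 (v := fun x => lam x ^ 2) (f := fun _ => 1 + K * ((n : ℝ) - 1)) (hlam.pow 2)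
      (fun x => pow_pos (hφc.pos x) 2)]
    · exact horizontalGradient_const hφc.smooth _ p
    · intro x
      have hx := hφc.pos x
      have hmn : (m : ℝ) - n ≠ 0 := sub_ne_zero.2 (by exact_mod_cast hnm.ne')
      -- The m - n vertical directions contribute λ^(4-2n) to v², and the n horizontal ones λ^(2n),
      -- so v² = λ⁴.
      have h1 : c x ^ (m - n) = lam x ^ (4 - 2 * (n : ℝ)) := by
        rw [hcdef, ← Real.rpow_natCast, ← Real.rpow_mul (hρ0 x).le, Nat.cast_sub hnm.le, hr,
          div_mul_cancel₀ _ hmn, one_div, Real.inv_rpow hx.le, ← Real.rpow_neg hx.le, neg_sub]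
      rw [h1, hce, ← pow_mul, ← pow_mul, ← Real.rpow_natCast, ← Real.rpow_natCast,
        ← Real.rpow_add hx]
      congr 1
      push_cast
      ring
    · intro x
      have := (hφc.pos x).ne'
      simp only [hce]
      field_simp

theorem isConformalMetric_of_isRelatedMetric {c : M → ℝ}
    (hG : IsRelatedMetric g h φ c (fun _ => 0) G) : IsConformalMetric g c G := fun x v w => by
  rw [hG, zero_mul, add_zero]

/-- Here c = b², e = 0 and v = b^m, so f = b^(m-2) + K(n-1) b^(m-4) λ². The integer exponent allows
m < 4. -/
theorem exists_conformal_critical_iff (hn : 0 < n) (hnm : n < m)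
    (hφ : IsSubmersiveHarmonicMorphism g h φ lam) (K : ℝ) {b : M → ℝ}
    (hb : ContMDiff (𝓡 m) 𝓘(ℝ, ℝ) ∞ b) (hb0 : ∀ x, 0 < b x) :
    ∃ G : SmoothMetric m M, IsConformalMetric g (fun x => b x ^ 2) G ∧
      (IsSigmaOneTwoCritical K G h φ ↔ ∀ x, horizontalGradient n g φ
        (fun y => b y ^ ((m : ℤ) - 4) * (b y ^ 2 + K * ((n : ℝ) - 1) * lam y ^ 2)) x = 0) := by
  have hφc := hφ.toIsHorizontallyConformal
  have hc0 : ∀ x, 0 < b x ^ 2 := fun x => pow_pos (hb0 x) 2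
  have hce0 : ∀ x, 0 < b x ^ 2 + 0 * lam x ^ 2 := fun x => by
    rw [zero_mul, add_zero]; exact hc0 x
  obtain ⟨G, hG⟩ := exists_isRelatedMetric hφc (hb.pow 2) (e := fun _ => 0) contMDiff_const hc0 hce0
  refine ⟨G, isConformalMetric_of_isRelatedMetric hG, forall_congr' fun p => ?_⟩
  rw [← one_smul ℝ (tension G h φ p)]
  refine tension_add_sigmaTwoTension_eq_zero_iff hn hnm.le hφ hG (hb.pow 2) contMDiff_const
    hc0 hce0 (v := fun x => b x ^ m) (hb.pow m) (fun x => pow_pos (hb0 x) m) (fun x => ?_) 1 K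
    fun x => ?_
  · rw [zero_mul, add_zero, ← pow_add, Nat.sub_add_cancel hnm.le, ← pow_mul, ← pow_mul, mul_comm]
  · have hx := (hb0 x).ne'
    rw [zero_mul, add_zero, zpow_sub₀ hx, zpow_natCast]
    norm_cast
    field_simp

/-- For G = c g the σ₂ part of f is (n-1) c^(m/2-2) λ². It is the constant n - 1 when c =
λ^(4/(4-m)); for m = 4 the factor c drops out and cannot compensate λ². -/
theorem exists_conformal_sigmaTwoCritical (hn : 0 < n) (hnm : n < m)
    (hφ : IsSubmersiveHarmonicMorphism g h φ lam) (hm : m ≠ 4) :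
    ∃ G : SmoothMetric m M,
      IsConformalMetric g (fun x => lam x ^ ((4 : ℝ) / (4 - (m : ℝ)))) G ∧
      IsSigmaTwoCritical G h φ := by
  have hφc := hφ.toIsHorizontallyConformal
  have hlam := dilation_contMDiff hn hφc
  have hm4 : (4 : ℝ) - m ≠ 0 := sub_ne_zero.2 (by exact_mod_cast hm.symm)
  have hc := contMDiff_rpow hlam hφc.pos ((4 : ℝ) / (4 - (m : ℝ)))
  have hc0 : ∀ x, 0 < lam x ^ ((4 : ℝ) / (4 - (m : ℝ))) := fun x =>
    Real.rpow_pos_of_pos (hφc.pos x) _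
  have hce0 : ∀ x, 0 < lam x ^ ((4 : ℝ) / (4 - (m : ℝ))) + 0 * lam x ^ 2 := fun x => by
    rw [zero_mul, add_zero]; exact hc0 x
  obtain ⟨G, hG⟩ := exists_isRelatedMetric hφc hc (e := fun _ => 0) contMDiff_const hc0 hce0
  refine ⟨G, isConformalMetric_of_isRelatedMetric hG, fun p => ?_⟩
  have key := (tension_add_sigmaTwoTension_eq_zero_iff (p := p) hn hnm.le hφ hG hc contMDiff_const
    hc0 hce0 (v := fun x => lam x ^ ((2 * (m : ℝ)) / (4 - (m : ℝ))))
    (f := fun _ => (n : ℝ) - 1) (contMDiff_rpow hlam hφc.pos _)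
    (fun x => Real.rpow_pos_of_pos (hφc.pos x) _) (fun x => ?_) 0 1 fun x => ?_).2
    (horizontalGradient_const hφc.smooth _ p)
  · rwa [zero_smul, zero_add, one_smul] at key
  · have hx := hφc.pos x
    rw [zero_mul, add_zero, ← pow_add, Nat.sub_add_cancel hnm.le, ← Real.rpow_natCast,
      ← Real.rpow_natCast, ← Real.rpow_mul hx.le, ← Real.rpow_mul hx.le]
    congr 1
    push_cast
    ring
  · have hx := hφc.pos x
    have h1 : lam x ^ ((2 * (m : ℝ)) / (4 - (m : ℝ))) * lam x ^ 2 =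
        (lam x ^ ((4 : ℝ) / (4 - (m : ℝ)))) ^ 2 := by
      rw [← Real.rpow_natCast, ← Real.rpow_natCast, ← Real.rpow_mul hx.le, ← Real.rpow_add hx]
      congr 1
      push_cast
      field_simp
      ring
    rw [zero_mul, zero_mul, add_zero, h1, div_self (pow_pos (hc0 x) 2).ne']
    ring

end Criteria

end SigmaCritical

end

theorem mainTheorem1 {m n : ℕ} (hn : 0 < n) (hnm : n < m)
    {M : Type*} [TopologicalSpace M] [ChartedSpace (SigmaCritical.E m) M] [IsManifold (𝓡 m) ∞ M]
    {N : Type*} [TopologicalSpace N] [ChartedSpace (SigmaCritical.E n) N] [IsManifold (𝓡 n) ∞ N]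
    (g : SigmaCritical.SmoothMetric m M) (h : SigmaCritical.SmoothMetric n N)
    (φ : M → N) (lam : M → ℝ) (hφ : SigmaCritical.IsSubmersiveHarmonicMorphism g h φ lam) :
    (∃ G : SigmaCritical.SmoothMetric m M,
      SigmaCritical.IsBiconformalMetric n g φ (fun x => 1 / lam x) G ∧
      ∀ K : ℝ, SigmaCritical.IsSigmaOneTwoCritical K G h φ) ∧
    (∀ (K : ℝ) (b : M → ℝ), ContMDiff (𝓡 m) 𝓘(ℝ, ℝ) ∞ b → (∀ x, 0 < b x) →
      ∃ G : SigmaCritical.SmoothMetric m M,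
        SigmaCritical.IsConformalMetric g (fun x => b x ^ 2) G ∧
        (SigmaCritical.IsSigmaOneTwoCritical K G h φ ↔
          ∀ x, SigmaCritical.horizontalGradient n g φ
            (fun y => b y ^ ((m : ℤ) - 4) * (b y ^ 2 + K * ((n : ℝ) - 1) * lam y ^ 2)) x = 0)) ∧
    (m ≠ 4 → ∃ G : SigmaCritical.SmoothMetric m M,
      SigmaCritical.IsConformalMetric g (fun x => lam x ^ ((4 : ℝ) / (4 - (m : ℝ)))) G ∧
      SigmaCritical.IsSigmaTwoCritical G h φ) :=
  ⟨SigmaCritical.exists_biconformal_critical hn hnm hφ,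
    fun K _ hb hb0 => SigmaCritical.exists_conformal_critical_iff hn hnm hφ K hb hb0,
    SigmaCritical.exists_conformal_sigmaTwoCritical hn hnm hφ⟩
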